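/- Throughout, $\log$ is the base-2 logarithm. Inputs are points of $\{-1,1\}^n$, where $-1$ means true and $1$ means false. A DNF is an OR $T_1\vee\cdots\vee T_s$ of terms, each term being an AND of literals (variables or negated variables); it is identified with the function $f:\{-1,1\}^n\to\{0,1\}$ that it computes. A DNF has width $w$ if each of its terms involves at most $w$ variables, and read $k$ if each variable occurs in at most $k$ of its terms. For $S\subseteq[n]$ let $\hat f(S)=\mathbb{E}_{x\in\{-1,1\}^n}\bigl[f(x)\prod_{i\in S}x_i\bigr]$, with $x$ uniform. The function $f$ is $\epsilon$-concentrated on $M$ coefficients if there is a family $\mathcal S$ of at most $M$ subsets of $[n]$ with $\sum_{S\notin\mathcal S}\hat f(S)^2\le\epsilon$. **Theorem.** There is an absolute constant $C>0$ such that the following holds for all integers $n\ge 0$, $w\ge 3$, $k\ge 0$ and all real $0<\epsilon\le 1$. If $f$ is a DNF in $n$ variables that has width $w$ and read $k$, where $$k\le\frac{\log w}{16\log\log w},$$ then $f$ is $\epsilon$-concentrated on $2^{C w\log(1/\epsilon)}$ coefficients. -/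

import Mathlib

noncomputable section

namespace BooleanDNF

/-- The cube `{-1,1}^n`; the value `-1` means true and `1` means false. -/
abbrev Cube (n : ℕ) : Type := Fin n → ℤˣ

/-- The monomial `x^S = ∏_{i ∈ S} x_i`. -/
def monomial {n : ℕ} (S : Finset (Fin n)) (x : Cube n) : ℝ :=
  ∏ i ∈ S, ((x i : ℤ) : ℝ)

/-- The Fourier coefficient of `f` at `S`: the mean of `f(x) x^S` over the uniform cube. -/
def fourierCoeff {n : ℕ} (f : Cube n → ℝ) (S : Finset (Fin n)) : ℝ :=
  (∑ x : Cube n, f x * monomial S x) / 2 ^ n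

/-- `f` is `ε`-concentrated on the family `𝓢`: the squared Fourier coefficients at sets outside
`𝓢` sum to at most `ε`. -/
def ConcentratedOn {n : ℕ} (f : Cube n → ℝ) (ε : ℝ) (𝓢 : Finset (Finset (Fin n))) : Prop :=
  ∑ S ∈ 𝓢ᶜ, fourierCoeff f S ^ 2 ≤ ε

/-- `f` is `ε`-concentrated on `M` coefficients. -/
def ConcentratedOnCoeffs {n : ℕ} (f : Cube n → ℝ) (ε M : ℝ) : Prop :=
  ∃ 𝓢 : Finset (Finset (Fin n)), (𝓢.card : ℝ) ≤ M ∧ ConcentratedOn f ε 𝓢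

/-- A term is a conjunction of literals. The literal `(i, -1)` is the variable `x_i`, the literal
`(i, 1)` is its negation: the literal `(i, a)` holds at `x` when `x i = a`. -/
abbrev DNFTerm (n : ℕ) : Type := Finset (Fin n × ℤˣ)

/-- The set of variables queried by a term. -/
def DNFTerm.vars {n : ℕ} (T : DNFTerm n) : Finset (Fin n) := T.image Prod.fst

/-- The term `T` is satisfied by `x`. -/
def DNFTerm.Sat {n : ℕ} (T : DNFTerm n) (x : Cube n) : Prop := ∀ l ∈ T, x l.1 = l.2

/-- A DNF formula `T_1 ∨ ⋯ ∨ T_s` in `n` variables. -/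
structure DNF (n : ℕ) where
  /-- the number of terms -/
  size : ℕ
  /-- the terms -/
  term : Fin size → DNFTerm n

namespace DNF

variable {n : ℕ}

open Classical in
/-- The function `{-1,1}^n → {0,1}` computed by a DNF. -/
def eval (F : DNF n) (x : Cube n) : ℝ := if ∃ j, (F.term j).Sat x then 1 else 0

/-- Each term queries at most `w` variables. -/
def HasWidth (F : DNF n) (w : ℕ) : Prop := ∀ j, (F.term j).vars.card ≤ w

/-- Each variable occurs in at most `k` terms. -/
def HasRead (F : DNF n) (k : ℕ) : Prop :=
  ∀ i : Fin n, (Finset.univ.filter fun j => i ∈ (F.term j).vars).card ≤ k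

end DNF

end BooleanDNF

end

/-! Let `τ = ⌈log(1/ε)⌉`. If more than `k·u·2^u·τ` satisfiable terms have width at most `u`, then at
least `2^u·τ` of them query disjoint sets of variables. All of these fail with probability at most
`2^{-τ}`, so `{∅}` carries enough weight (`nearly_const_or_few_terms`). Hence short terms may be
assumed scarce for every `u`.

Put `m = 200k²`. A variable lies in at most `k` terms. By pigeonhole, each variable of a satisfiable
term of width at most `m` therefore has a scale `W = m^a`, `1 ≤ a ≤ k`, at which its satisfiable
terms jump from width at most `W` to width above `mW` (`vars_subset_biUnion_gapVars`). A switching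
lemma holds for the variables with a gap at scale `W`: short terms cost a factor `4W` per variable,
and long terms, being few and rarely alive, cost only `e^τ` in total
(`sum_powersetCard_fourierCoeff_sq_le`, `sum_gapVars_le`). So a typical `S` contains `O(τkW)` gap
variables per scale. Let `X` be the set of all gap variables. Since `k²m^{2k}` is far below `w`, the
typical traces `S ∩ X` number at most `2^{wτ}`.

A satisfiable term that leaves `X` has width above `m`. A restricted top coefficient at `S` vanishes
unless alive terms of this kind cover `S \ X`, so the coefficient at `S` is at most the sum, over
covers `A`, of `2^{|S|-|supp A|}` (`abs_fourierCoeff_le_sum_covers`). Width above `m` outweighs the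
read, so the sum of `3^{-|supp A|}` over all families of such terms is at most `e^τ`
(`sum_third_pow_card_support_le`, `sum_long_terms_le`). Keep the sets with typical trace whose
remainder has a cover on `O(wτ)` variables. They are few (`card_coveredSets_le`), and the rest has
small weight by geometric decay (`sum_not_covered_le`), because the ordinary switching lemma gives
`|S| = O(wτ)` (`sum_card_ge_le`). -/

noncomputable section

namespace BooleanDNF

open Finset

variable {n : ℕ}

/-! ### Subcubes and averages over them -/

/-- The points that agree with `x` outside `U`. -/
def cyl (U : Finset (Fin n)) (x : Cube n) : Finset (Cube n) :=
  univ.filter fun y => ∀ i, i ∉ U → y i = x i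

@[simp]
lemma mem_cyl {U : Finset (Fin n)} {x y : Cube n} : y ∈ cyl U x ↔ ∀ i, i ∉ U → y i = x i := by
  simp [cyl]

lemma self_mem_cyl (U : Finset (Fin n)) (x : Cube n) : x ∈ cyl U x := by simp

lemma mem_cyl_symm {U : Finset (Fin n)} {x y : Cube n} : y ∈ cyl U x ↔ x ∈ cyl U y := by
  simp only [mem_cyl]
  exact forall₂_congr fun _ _ => eq_comm

lemma mem_cyl_trans {U V : Finset (Fin n)} {x y z : Cube n} (hUV : U ⊆ V)
    (hy : y ∈ cyl V x) (hz : z ∈ cyl U y) : z ∈ cyl V x := by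
  simp only [mem_cyl] at *
  intro i hi
  rw [hz i fun h => hi (hUV h), hy i hi]

lemma cyl_mono {U V : Finset (Fin n)} (hUV : U ⊆ V) (x : Cube n) : cyl U x ⊆ cyl V x :=
  fun _ hy => mem_cyl_trans hUV (self_mem_cyl V x) hy

lemma card_cyl (U : Finset (Fin n)) (x : Cube n) : (cyl U x).card = 2 ^ U.card := by
  have : cyl U x = Fintype.piFinset fun i => if i ∈ U then univ else {x i} := by
    ext y
    simp only [mem_cyl, Fintype.mem_piFinset]
    refine forall_congr' fun i => ?_
    by_cases hi : i ∈ U <;> simp [hi, Int.units_eq_one_or]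
  rw [this, Fintype.card_piFinset]
  have h2 : ∀ i, (if i ∈ U then (univ : Finset ℤˣ) else {x i}).card = if i ∈ U then 2 else 1 := by
    intro i
    split_ifs <;> simp
  simp_rw [h2]
  rw [Finset.prod_ite_mem]
  simp

lemma card_cube : (univ : Finset (Cube n)).card = 2 ^ n := by
  simp [Finset.card_univ]

/-- The mean of `g` over the points that agree with `x` outside `U`. -/
def avg (U : Finset (Fin n)) (g : Cube n → ℝ) (x : Cube n) : ℝ :=
  (∑ y ∈ cyl U x, g y) / 2 ^ U.card

lemma avg_mono {U : Finset (Fin n)} {g h : Cube n → ℝ} {x : Cube n}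
    (H : ∀ y ∈ cyl U x, g y ≤ h y) : avg U g x ≤ avg U h x := by
  unfold avg
  gcongr with y hy
  exact H y hy

lemma avg_congr {U : Finset (Fin n)} {g h : Cube n → ℝ} {x : Cube n}
    (H : ∀ y ∈ cyl U x, g y = h y) : avg U g x = avg U h x := by
  unfold avg
  rw [sum_congr rfl H]

lemma avg_const (U : Finset (Fin n)) (c : ℝ) (x : Cube n) : avg U (fun _ => c) x = c := by
  unfold avg
  rw [sum_const, card_cyl, nsmul_eq_mul]
  push_cast
  field_simp

lemma avg_const_mul (U : Finset (Fin n)) (c : ℝ) (g : Cube n → ℝ) (x : Cube n) :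
    avg U (fun y => c * g y) x = c * avg U g x := by
  unfold avg
  rw [← mul_sum, mul_div_assoc]

lemma avg_mul_left {U : Finset (Fin n)} {g h : Cube n → ℝ} {x : Cube n}
    (H : ∀ y ∈ cyl U x, g y = g x) : avg U (fun y => g y * h y) x = g x * avg U h x := by
  rw [← avg_const_mul]
  exact avg_congr fun y hy => by rw [H y hy]

lemma abs_avg_le (U : Finset (Fin n)) (g : Cube n → ℝ) (x : Cube n) :
    |avg U g x| ≤ avg U (fun y => |g y|) x := by
  unfold avg
  rw [abs_div, abs_of_pos (by positivity : (0 : ℝ) < 2 ^ U.card)]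
  gcongr
  exact abs_sum_le_sum_abs _ _

lemma avg_avg {U V : Finset (Fin n)} (hUV : Disjoint U V) (g : Cube n → ℝ) (x : Cube n) :
    avg U (avg V g) x = avg (U ∪ V) g x := by
  unfold avg
  rw [← sum_div, div_div, card_union_of_disjoint hUV, ← pow_add, add_comm V.card]
  congr 1
  rw [sum_comm' (t' := cyl (U ∪ V) x) (s' := fun z => {V.piecewise x z})]
  · simp
  · intro y z
    simp only [mem_cyl, mem_singleton, mem_union, not_or]
    constructor
    · rintro ⟨hy, hz⟩
      refine ⟨?_, fun i hi => by rw [hz i hi.2, hy i hi.1]⟩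
      ext i
      by_cases hi : i ∈ V
      · rw [piecewise_eq_of_mem _ _ _ hi, hy i fun h => disjoint_left.1 hUV h hi]
      · rw [piecewise_eq_of_notMem _ _ _ hi, hz i hi]
    · rintro ⟨rfl, hz⟩
      constructor
      · intro i hi
        by_cases hi' : i ∈ V
        · rw [piecewise_eq_of_mem _ _ _ hi']
        · rw [piecewise_eq_of_notMem _ _ _ hi', hz i ⟨hi, hi'⟩]
      · intro i hi
        rw [piecewise_eq_of_notMem _ _ _ hi]

lemma sum_avg (U : Finset (Fin n)) (g : Cube n → ℝ) : ∑ x, avg U g x = ∑ x, g x := by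
  unfold avg
  rw [← sum_div, sum_comm' (t' := univ) (s' := fun y => cyl U y)]
  · simp only [sum_const, card_cyl, nsmul_eq_mul]
    rw [← mul_sum]
    push_cast
    field_simp
  · intro x y
    simp only [mem_univ, true_and, and_true]
    exact mem_cyl_symm

/-- Flipping coordinate `i` is a fixed-point-free involution of the subcube, and it pairs each value
with its negative. -/
lemma sum_cyl_eq_zero {U : Finset (Fin n)} {h : Cube n → ℝ} {x : Cube n} {i : Fin n} (hi : i ∈ U)
    (H : ∀ y ∈ cyl U x, h (Function.update y i (-y i)) = -h y) : ∑ y ∈ cyl U x, h y = 0 := by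
  refine sum_involution (fun y _ => Function.update y i (-y i)) ?_ ?_ ?_ ?_
  · intro y hy
    rw [H y hy, add_neg_cancel]
  · intro y hy _ he
    have := congrFun he i
    simp only [Function.update_self] at this
    rcases Int.units_eq_one_or (y i) with h | h <;> rw [h] at this <;> exact absurd this (by decide)
  · intro y hy
    rw [mem_cyl] at hy ⊢
    intro j hj
    rw [Function.update_of_ne (fun h => hj (by rwa [h])), hy j hj]
  · intro y hy
    ext j
    by_cases hj : j = i
    · subst hj; simp
    · simp [hj]

/-! ### Monomials and Bessel's inequality -/

lemma monomial_empty (x : Cube n) : monomial ∅ x = 1 := by simp [monomial]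

lemma monomial_union {S T : Finset (Fin n)} (h : Disjoint S T) (x : Cube n) :
    monomial (S ∪ T) x = monomial S x * monomial T x := prod_union h

lemma monomial_congr {S : Finset (Fin n)} {x y : Cube n} (h : ∀ i ∈ S, x i = y i) :
    monomial S x = monomial S y :=
  prod_congr rfl fun i hi => by rw [h i hi]

lemma abs_monomial (S : Finset (Fin n)) (x : Cube n) : |monomial S x| = 1 := by
  unfold monomial
  rw [abs_prod]
  refine prod_eq_one fun i _ => ?_
  rcases Int.units_eq_one_or (x i) with h | h <;> simp [h]

lemma monomial_mul_self (S : Finset (Fin n)) (x : Cube n) : monomial S x * monomial S x = 1 := by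
  rw [← abs_mul_abs_self, abs_monomial, one_mul]

lemma monomial_update_of_mem {S : Finset (Fin n)} {i : Fin n} (hi : i ∈ S) (x : Cube n) :
    monomial S (Function.update x i (-x i)) = -monomial S x := by
  unfold monomial
  rw [← mul_prod_erase S _ hi, ← mul_prod_erase S (fun i => ((x i : ℤ) : ℝ)) hi, ← neg_mul]
  congr 1
  · simp
  · refine prod_congr rfl fun j hj => ?_
    rw [Function.update_of_ne (ne_of_mem_erase hj)]

lemma monomial_update_of_notMem {S : Finset (Fin n)} {i : Fin n} (hi : i ∉ S) (x : Cube n) :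
    monomial S (Function.update x i (-x i)) = monomial S x :=
  monomial_congr fun j hj => Function.update_of_ne (fun h => hi (by rwa [← h])) _ _

lemma sum_monomial_mul_monomial {S T : Finset (Fin n)} (h : S ≠ T) :
    ∑ x : Cube n, monomial S x * monomial T x = 0 := by
  have key : ∀ {A B : Finset (Fin n)} {i : Fin n}, i ∈ A → i ∉ B →
      ∑ x : Cube n, monomial A x * monomial B x = 0 := by
    intro A B i hA hB
    have hu : (univ : Finset (Cube n)) = cyl univ 1 := by ext; simp
    rw [hu]
    refine sum_cyl_eq_zero (mem_univ i) fun y _ => ?_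
    rw [monomial_update_of_mem hA, monomial_update_of_notMem hB, neg_mul]
  by_cases hST : S ⊆ T
  · obtain ⟨i, hi, hi'⟩ := not_subset.1 fun hTS => h (hST.antisymm hTS)
    simp_rw [mul_comm (monomial S _)]
    exact key hi hi'
  · obtain ⟨i, hi, hi'⟩ := not_subset.1 hST
    exact key hi hi'

/-- Bessel's inequality on the cube. -/
lemma sum_fourierCoeff_sq_le (g : Cube n → ℝ) :
    ∑ S, fourierCoeff g S ^ 2 ≤ (∑ x, g x ^ 2) / 2 ^ n := by
  have hN : (0 : ℝ) < 2 ^ n := by positivity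
  have h0 : 0 ≤ ∑ x, (g x - ∑ S, fourierCoeff g S * monomial S x) ^ 2 :=
    sum_nonneg fun x _ => sq_nonneg _
  have h1 : ∑ x, g x * ∑ S, fourierCoeff g S * monomial S x
      = 2 ^ n * ∑ S, fourierCoeff g S ^ 2 := by
    simp_rw [mul_sum]
    rw [sum_comm]
    refine sum_congr rfl fun S _ => ?_
    have : ∑ x, g x * monomial S x = 2 ^ n * fourierCoeff g S := by
      unfold fourierCoeff; field_simp
    rw [sq, ← mul_assoc, ← this, sum_mul]
    exact sum_congr rfl fun x _ => by ring
  have h2 : ∑ x : Cube n, (∑ S, fourierCoeff g S * monomial S x) ^ 2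
      = 2 ^ n * ∑ S, fourierCoeff g S ^ 2 := by
    simp_rw [sq, sum_mul_sum]
    rw [sum_comm, mul_sum]
    refine sum_congr rfl fun S _ => ?_
    rw [sum_comm]
    rw [sum_eq_single S]
    · have : ∀ x : Cube n, fourierCoeff g S * monomial S x * (fourierCoeff g S * monomial S x)
          = fourierCoeff g S * fourierCoeff g S := by
        intro x
        linear_combination (fourierCoeff g S * fourierCoeff g S) * monomial_mul_self S x
      simp_rw [this]
      rw [sum_const, card_cube, nsmul_eq_mul]
      push_cast; ring
    · intro T _ hT
      have : ∀ x : Cube n, fourierCoeff g S * monomial S x * (fourierCoeff g T * monomial T x)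
          = fourierCoeff g S * fourierCoeff g T * (monomial S x * monomial T x) := by
        intro x; ring
      simp_rw [this]
      rw [← mul_sum, sum_monomial_mul_monomial hT.symm, mul_zero]
    · simp
  have h3 : ∑ x, (g x - ∑ S, fourierCoeff g S * monomial S x) ^ 2
      = ∑ x, g x ^ 2 - 2 ^ n * ∑ S, fourierCoeff g S ^ 2 := by
    have : ∀ x, (g x - ∑ S, fourierCoeff g S * monomial S x) ^ 2
        = g x ^ 2 - 2 * (g x * ∑ S, fourierCoeff g S * monomial S x)
          + (∑ S, fourierCoeff g S * monomial S x) ^ 2 := fun x => by ring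
    simp_rw [this]
    rw [sum_add_distrib, sum_sub_distrib, ← mul_sum, h1, h2]
    ring
  rw [h3] at h0
  rw [le_div_iff₀ hN]
  linarith

/-! ### Top coefficients of restrictions -/

/-- The coefficient of `f` at the full set `U`, after the variables outside `U` are fixed as
in `x`. -/
def topCoeff (f : Cube n → ℝ) (U : Finset (Fin n)) (x : Cube n) : ℝ :=
  avg U (fun y => f y * monomial U y) x

lemma abs_topCoeff_le_one {f : Cube n → ℝ} (hf : ∀ x, |f x| ≤ 1) (U : Finset (Fin n))
    (x : Cube n) : |topCoeff f U x| ≤ 1 := by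
  refine (abs_avg_le _ _ _).trans ?_
  rw [← avg_const U 1 x]
  refine avg_mono fun y _ => ?_
  rw [abs_mul, abs_monomial, mul_one]
  exact hf y

lemma topCoeff_eq_zero {f : Cube n → ℝ} {U : Finset (Fin n)} {x : Cube n} {i : Fin n}
    (hi : i ∈ U) (H : ∀ y ∈ cyl U x, f (Function.update y i (-y i)) = f y) :
    topCoeff f U x = 0 := by
  unfold topCoeff avg
  rw [sum_cyl_eq_zero hi, zero_div]
  intro y hy
  rw [H y hy, monomial_update_of_mem hi, mul_neg]

/-- The factor `x^U` is a constant sign while `V` is averaged, so the absolute value removes it.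
This permits variables to be fixed block by block. -/
lemma abs_topCoeff_union_le {U V : Finset (Fin n)} (hUV : Disjoint U V) (f : Cube n → ℝ)
    (x : Cube n) : |topCoeff f (U ∪ V) x| ≤ avg U (fun y => |topCoeff f V y|) x := by
  unfold topCoeff
  rw [← avg_avg hUV]
  refine (abs_avg_le _ _ _).trans (avg_mono fun y _ => ?_)
  have : avg V (fun z => f z * monomial (U ∪ V) z) y
      = monomial U y * avg V (fun z => f z * monomial V z) y := by
    rw [← avg_mul_left (g := monomial U)]
    · refine avg_congr fun z _ => ?_
      rw [monomial_union hUV]; ring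
    · intro z hz
      exact monomial_congr fun i hi => mem_cyl.1 hz i (disjoint_left.1 hUV hi)
  rw [this, abs_mul, abs_monomial, one_mul]

lemma fourierCoeff_topCoeff {U S : Finset (Fin n)} (hUS : U ⊆ S) (f : Cube n → ℝ) :
    fourierCoeff (topCoeff f U) (S \ U) = fourierCoeff f S := by
  unfold fourierCoeff
  congr 1
  rw [← sum_avg U (fun x => f x * monomial S x)]
  refine sum_congr rfl fun x _ => ?_
  unfold topCoeff
  rw [mul_comm, ← avg_mul_left (g := monomial (S \ U))]
  · refine avg_congr fun y _ => ?_
    conv_rhs => rw [← sdiff_union_of_subset hUS, monomial_union sdiff_disjoint]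
    ring
  · intro y hy
    exact monomial_congr fun i hi => mem_cyl.1 hy i (mem_sdiff.1 hi).2

/-- The coefficients of `f` above `U` are coefficients of `topCoeff f U`, at the distinct sets `S \
U`, so Bessel applies. -/
lemma sum_superset_fourierCoeff_sq_le (f : Cube n → ℝ) (U : Finset (Fin n)) :
    ∑ S with U ⊆ S, fourierCoeff f S ^ 2 ≤ (∑ x, topCoeff f U x ^ 2) / 2 ^ n := by
  refine le_trans ?_ (sum_fourierCoeff_sq_le (topCoeff f U))
  have hinj : Set.InjOn (fun S => S \ U) ((univ.filter fun S => U ⊆ S : Finset _) : Set _) := by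
    intro S hS T hT h
    simp only [coe_filter, mem_univ, true_and, Set.mem_ofPred_eq] at hS hT h
    rw [← sdiff_union_of_subset hS, h, sdiff_union_of_subset hT]
  calc ∑ S with U ⊆ S, fourierCoeff f S ^ 2
      = ∑ S with U ⊆ S, fourierCoeff (topCoeff f U) (S \ U) ^ 2 :=
        sum_congr rfl fun S hS => by rw [fourierCoeff_topCoeff (mem_filter.1 hS).2]
    _ = ∑ S ∈ (univ.filter fun S => U ⊆ S).image (fun S => S \ U),
          fourierCoeff (topCoeff f U) S ^ 2 := by rw [sum_image hinj]
    _ ≤ _ := sum_le_sum_of_subset_of_nonneg (subset_univ _) fun _ _ _ => sq_nonneg _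

lemma fourierCoeff_eq_sum_topCoeff (f : Cube n → ℝ) (S : Finset (Fin n)) :
    fourierCoeff f S = (∑ x, topCoeff f S x) / 2 ^ n := by
  rw [← fourierCoeff_topCoeff subset_rfl, sdiff_self]
  simp [fourierCoeff, monomial]

namespace DNF

/-! ### Alive terms -/

/-- Some setting of the variables in `U` satisfies the `j`-th term, the other variables being as
in `x`. -/
def Alive (F : DNF n) (U : Finset (Fin n)) (x : Cube n) (j : Fin F.size) : Prop :=
  ∃ y ∈ cyl U x, (F.term j).Sat y

/-- The variables queried by the terms in `A`. -/
def support (F : DNF n) (A : Finset (Fin F.size)) : Finset (Fin n) :=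
  A.biUnion fun j => (F.term j).vars

lemma sat_congr (F : DNF n) {j : Fin F.size} {x y : Cube n}
    (h : ∀ i ∈ (F.term j).vars, x i = y i) : (F.term j).Sat x ↔ (F.term j).Sat y := by
  refine forall₂_congr fun l hl => ?_
  rw [h l.1 (mem_image_of_mem _ hl)]

lemma Alive.mono {F : DNF n} {U V : Finset (Fin n)} {x : Cube n} {j : Fin F.size}
    (h : F.Alive U x j) (hUV : (F.term j).vars ∩ U ⊆ V) : F.Alive V x j := by
  obtain ⟨y, hy, hs⟩ := h
  refine ⟨V.piecewise y x, ?_, ?_⟩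
  · rw [mem_cyl]
    intro i hi
    rw [piecewise_eq_of_notMem _ _ _ hi]
  · refine (F.sat_congr fun i hi => ?_).1 hs
    by_cases hV : i ∈ V
    · rw [piecewise_eq_of_mem _ _ _ hV]
    · rw [piecewise_eq_of_notMem _ _ _ hV]
      exact mem_cyl.1 hy i fun hU => hV (hUV (mem_inter.2 ⟨hi, hU⟩))

lemma Alive.congr {F : DNF n} {U : Finset (Fin n)} {x y : Cube n} {j : Fin F.size}
    (h : F.Alive U x j) (hxy : ∀ i ∈ (F.term j).vars \ U, x i = y i) : F.Alive U y j := by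
  obtain ⟨z, hz, hs⟩ := h
  refine ⟨U.piecewise z y, ?_, ?_⟩
  · rw [mem_cyl]
    intro i hi
    rw [piecewise_eq_of_notMem _ _ _ hi]
  · refine (F.sat_congr fun i hi => ?_).1 hs
    by_cases hU : i ∈ U
    · rw [piecewise_eq_of_mem _ _ _ hU]
    · rw [piecewise_eq_of_notMem _ _ _ hU, mem_cyl.1 hz i hU, hxy i (mem_sdiff.2 ⟨hi, hU⟩)]

lemma alive_iff_of_mem_cyl {F : DNF n} {U : Finset (Fin n)} {x y : Cube n} {j : Fin F.size}
    (hy : y ∈ cyl U x) : F.Alive U y j ↔ F.Alive U x j :=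
  ⟨fun h => h.congr fun i hi => mem_cyl.1 hy i (mem_sdiff.1 hi).2,
    fun h => h.congr fun i hi => (mem_cyl.1 hy i (mem_sdiff.1 hi).2).symm⟩

lemma Alive.exists_sat {F : DNF n} {U : Finset (Fin n)} {x : Cube n} {j : Fin F.size}
    (h : F.Alive U x j) : ∃ y, (F.term j).Sat y := h.imp fun _ hy => hy.2

lemma eval_nonneg (F : DNF n) (x : Cube n) : 0 ≤ F.eval x := by
  unfold eval; split_ifs <;> norm_num

lemma eval_le_one (F : DNF n) (x : Cube n) : F.eval x ≤ 1 := by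
  unfold eval; split_ifs <;> norm_num

lemma abs_eval_le_one (F : DNF n) (x : Cube n) : |F.eval x| ≤ 1 := by
  rw [abs_of_nonneg (F.eval_nonneg x)]; exact F.eval_le_one x

lemma eval_congr {F : DNF n} {x y : Cube n}
    (h : (∃ j, (F.term j).Sat x) ↔ ∃ j, (F.term j).Sat y) : F.eval x = F.eval y := by
  unfold eval
  by_cases hx : ∃ j, (F.term j).Sat x
  · rw [if_pos hx, if_pos (h.1 hx)]
  · rw [if_neg hx, if_neg fun hy => hx (h.2 hy)]

/-- On the subcube only alive terms can be satisfied, so the restricted function does not depend on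
`i`. -/
lemma topCoeff_eval_eq_zero {F : DNF n} {U : Finset (Fin n)} {x : Cube n} {i : Fin n}
    (hi : i ∈ U) (h : ∀ j, F.Alive U x j → i ∉ (F.term j).vars) : topCoeff F.eval U x = 0 := by
  refine topCoeff_eq_zero hi fun y hy => eval_congr (exists_congr fun j => ?_)
  by_cases hj : i ∈ (F.term j).vars
  · have hn : ∀ z ∈ cyl U x, ¬ (F.term j).Sat z := fun z hz hs => h j ⟨z, hz, hs⟩ hj
    refine iff_of_false (hn _ ?_) (hn _ hy)
    rw [mem_cyl] at hy ⊢
    intro k hk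
    rw [Function.update_of_ne (fun he => hk (by rwa [he])), hy k hk]
  · exact F.sat_congr fun k hk => Function.update_of_ne (fun he => hj (by rwa [← he])) _ _

open Classical in
/-- The points at which all terms in `A` are alive with respect to `U`. -/
def aliveSet (F : DNF n) (U : Finset (Fin n)) (A : Finset (Fin F.size)) : Finset (Cube n) :=
  univ.filter fun x => ∀ j ∈ A, F.Alive U x j

@[simp]
lemma mem_aliveSet {F : DNF n} {U : Finset (Fin n)} {A : Finset (Fin F.size)} {x : Cube n} :
    x ∈ F.aliveSet U A ↔ ∀ j ∈ A, F.Alive U x j := by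
  simp [aliveSet]

lemma card_fixed_le (B : Finset (Fin n)) (C : Finset (Cube n))
    (h : ∀ x ∈ C, ∀ y ∈ C, ∀ i ∈ B, x i = y i) :
    (C.card : ℝ) ≤ 2 ^ n * (1 / 2) ^ B.card := by
  have hB : B.card ≤ n := by simpa using card_le_univ B
  rcases C.eq_empty_or_nonempty with rfl | ⟨x, hx⟩
  · simp
  · have h1 : C ⊆ cyl Bᶜ x := by
      intro y hy
      rw [mem_cyl]
      intro i hi
      exact h y hy x hx i (by simpa using hi)
    have h2 := card_le_card h1
    rw [card_cyl, card_compl, Fintype.card_fin] at h2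
    calc (C.card : ℝ) ≤ 2 ^ (n - B.card) := by exact_mod_cast h2
      _ = _ := by
        rw [pow_sub₀ _ two_ne_zero hB]; simp

/-- An alive term dictates its literals outside `U`, so all points counted agree on `F.support A \
U`. -/
lemma card_aliveSet_le (F : DNF n) (U : Finset (Fin n)) (A : Finset (Fin F.size)) :
    ((F.aliveSet U A).card : ℝ) ≤ 2 ^ n * (1 / 2) ^ (F.support A \ U).card := by
  refine card_fixed_le _ _ fun x hx y hy i hi => ?_
  rw [mem_sdiff, support, mem_biUnion] at hi
  obtain ⟨⟨j, hj, hij⟩, hiU⟩ := hi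
  obtain ⟨l, hl, rfl⟩ := mem_image.1 hij
  obtain ⟨x', hx', hsx⟩ := mem_aliveSet.1 hx j hj
  obtain ⟨y', hy', hsy⟩ := mem_aliveSet.1 hy j hj
  rw [← mem_cyl.1 hx' _ hiU, ← mem_cyl.1 hy' _ hiU, hsx l hl, hsy l hl]

/-! ### Reachable pairs and canonical decision trees -/

/-- `T_j` is the first term satisfied by `x`. -/
def IsFirst (F : DNF n) (x : Cube n) (j : Fin F.size) : Prop :=
  (F.term j).Sat x ∧ ∀ i < j, ¬ (F.term i).Sat x

lemma IsFirst.unique {F : DNF n} {x : Cube n} {i j : Fin F.size} (hi : F.IsFirst x i)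
    (hj : F.IsFirst x j) : i = j :=
  le_antisymm (le_of_not_gt fun h => hi.2 j h hj.1) (le_of_not_gt fun h => hj.2 i h hi.1)

/-- `Reach C W U x`: starting from a point of `C`, the set `U` is read in nonempty blocks. Each
block is a set of variables of the first satisfied term, which has at most `W` variables, and the
values in the block are changed at will after it is read. -/
inductive Reach (F : DNF n) (C : Finset (Cube n)) (W : ℕ) : Finset (Fin n) → Cube n → Prop
  | base {x : Cube n} : x ∈ C → Reach F C W ∅ x
  | step {U V : Finset (Fin n)} {x y : Cube n} {j : Fin F.size} : Reach F C W U y →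
      F.IsFirst y j → (F.term j).vars.card ≤ W → V ⊆ (F.term j).vars → V.Nonempty →
      Disjoint U V → x ∈ cyl V y → Reach F C W (U ∪ V) x

open Classical in
/-- The pairs `(U, x)` with `|U| = d` that can be reached. -/
def reachSet (F : DNF n) (C : Finset (Cube n)) (W d : ℕ) : Finset (Finset (Fin n) × Cube n) :=
  univ.filter fun p => p.1.card = d ∧ F.Reach C W p.1 p.2

@[simp]
lemma mem_reachSet {F : DNF n} {C : Finset (Cube n)} {W d : ℕ} {p : Finset (Fin n) × Cube n} :
    p ∈ F.reachSet C W d ↔ p.1.card = d ∧ F.Reach C W p.1 p.2 := by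
  simp [reachSet]

open Classical in
/-- The pairs obtained from `p` by reading one more block of size `v`. -/
def reachStep (F : DNF n) (W v : ℕ) (p : Finset (Fin n) × Cube n) :
    Finset (Finset (Fin n) × Cube n) :=
  (univ.filter fun j => F.IsFirst p.2 j ∧ (F.term j).vars.card ≤ W).biUnion fun j =>
    ((F.term j).vars.powersetCard v).biUnion fun V =>
      (cyl V p.2).image fun x => (p.1 ∪ V, x)

/-- The point determines its first satisfied term, so only the block inside that term and the new
values in the block are free. -/
lemma card_reachStep_le (F : DNF n) (W v : ℕ) (p : Finset (Fin n) × Cube n) :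
    (F.reachStep W v p).card ≤ W.choose v * 2 ^ v := by
  classical
  unfold reachStep
  refine (card_biUnion_le_card_mul _ _ (W.choose v * 2 ^ v) fun j hj => ?_).trans ?_
  · refine (card_biUnion_le_card_mul _ _ (2 ^ v) fun V hV => ?_).trans ?_
    · refine card_image_le.trans ?_
      rw [card_cyl, (mem_powersetCard.1 hV).2]
    · rw [card_powersetCard]
      gcongr
      exact (mem_filter.1 hj).2.2
  · refine (Nat.mul_le_mul_right _ (card_le_one.2 fun i hi j hj => ?_)).trans (one_mul _).le
    exact (mem_filter.1 hi).2.1.unique (mem_filter.1 hj).2.1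

lemma card_reachSet_zero_le (F : DNF n) (C : Finset (Cube n)) (W : ℕ) :
    (F.reachSet C W 0).card ≤ C.card := by
  classical
  refine (card_le_card fun p hp => ?_).trans (card_image_le (s := C) (f := fun x => (∅, x)))
  rw [mem_reachSet] at hp
  obtain ⟨U, x⟩ := p
  obtain ⟨h0, hr⟩ := hp
  simp only [card_eq_zero] at h0
  cases hr with
  | base hx => exact mem_image_of_mem _ hx
  | step _ _ _ _ hV => exact absurd (union_eq_empty.1 h0).2 hV.ne_empty

lemma card_reachSet_le_sum (F : DNF n) (C : Finset (Cube n)) (W d : ℕ) (hd : d ≠ 0) :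
    (F.reachSet C W d).card
      ≤ ∑ v ∈ Icc 1 d, (F.reachSet C W (d - v)).card * (W.choose v * 2 ^ v) := by
  classical
  have hsub : F.reachSet C W d
      ⊆ (Icc 1 d).biUnion fun v => (F.reachSet C W (d - v)).biUnion (F.reachStep W v) := by
    rintro ⟨U, x⟩ hp
    obtain ⟨hc, hr⟩ := mem_reachSet.1 hp
    cases hr with
    | base hx => exact absurd hc.symm (by simpa using hd)
    | @step U V _ y j hr hj hW hV hne hdisj hx =>
      have hc : (U ∪ V).card = d := hc
      rw [card_union_of_disjoint hdisj] at hc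
      have := hne.card_pos
      refine mem_biUnion.2 ⟨V.card, mem_Icc.2 ⟨this, by lia⟩, mem_biUnion.2 ⟨(U, y), ?_, ?_⟩⟩
      · exact mem_reachSet.2 ⟨by simp only; lia, hr⟩
      · refine mem_biUnion.2 ⟨j, by simp [hj, hW], mem_biUnion.2 ⟨V, ?_, mem_image_of_mem _ hx⟩⟩
        exact mem_powersetCard.2 ⟨hV, rfl⟩
  refine (card_le_card hsub).trans (card_biUnion_le.trans (sum_le_sum fun v _ => ?_))
  exact card_biUnion_le_card_mul _ _ _ fun p _ => F.card_reachStep_le W v p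

/-- The base `4 * W` solves the recurrence on the last block: after division by `(4 * W) ^ d`, the
factors `W.choose v * (1 / (2 * W)) ^ v` with `v ≥ 1` sum to at most `e^{1/2} - 1 ≤ 1`. -/
lemma card_reachSet_le (F : DNF n) (C : Finset (Cube n)) {W : ℕ} (hW : 1 ≤ W) (d : ℕ) :
    ((F.reachSet C W d).card : ℝ) ≤ (4 * W) ^ d * C.card := by
  induction d using Nat.strong_induction_on with
  | _ d ih =>
    rcases eq_or_ne d 0 with rfl | hd
    · simpa using F.card_reachSet_zero_le C W
    have hW' : (0 : ℝ) < W := by exact_mod_cast hW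
    have h1 : ((F.reachSet C W d).card : ℝ)
        ≤ ∑ v ∈ Icc 1 d, ((F.reachSet C W (d - v)).card : ℝ) * (W.choose v * 2 ^ v) := by
      exact_mod_cast F.card_reachSet_le_sum C W d hd
    have h2 : ∀ v ∈ Icc 1 d, ((F.reachSet C W (d - v)).card : ℝ) * (W.choose v * 2 ^ v)
        ≤ (4 * W) ^ d * C.card * (W.choose v * (1 / (2 * W)) ^ v) := by
      intro v hv
      have hv' := mem_Icc.1 hv
      calc ((F.reachSet C W (d - v)).card : ℝ) * (W.choose v * 2 ^ v)
          ≤ ((4 * W) ^ (d - v) * C.card) * (W.choose v * 2 ^ v) := by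
            gcongr
            exact ih _ (by lia)
        _ = _ := by
            rw [pow_sub₀ _ (by positivity) hv'.2]
            have : (1 / (2 * (W : ℝ))) ^ v = ((4 * (W : ℝ)) ^ v)⁻¹ * 2 ^ v := by
              rw [← inv_pow, ← mul_pow]
              congr 1
              field_simp
              norm_num
            rw [this]; ring
    refine h1.trans ((sum_le_sum h2).trans ?_)
    rw [← mul_sum]
    refine mul_le_of_le_one_right (by positivity) ?_
    have h3 : ∑ v ∈ Icc 1 d, ((W.choose v : ℝ) * (1 / (2 * W)) ^ v) + 1
        ≤ ∑ v ∈ range (W + d + 1), ((W.choose v : ℝ) * (1 / (2 * W)) ^ v) := by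
      have : insert 0 (Icc 1 d) ⊆ range (W + d + 1) := by
        intro v hv
        simp only [mem_insert, mem_Icc, mem_range] at hv ⊢
        lia
      have h := sum_le_sum_of_subset_of_nonneg this
        (f := fun v => (W.choose v : ℝ) * (1 / (2 * (W : ℝ))) ^ v)
        fun _ _ _ => by positivity
      rw [sum_insert (by simp)] at h
      simp only [Nat.choose_zero_right, pow_zero] at h
      linarith
    have h4 : ∑ v ∈ range (W + d + 1), ((W.choose v : ℝ) * (1 / (2 * W)) ^ v)
        = (1 + 1 / (2 * (W : ℝ))) ^ W := by
      rw [add_comm (1 : ℝ), add_pow]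
      symm
      refine sum_subset_zero_on_sdiff (range_subset_range.2 (by lia)) ?_ ?_
      · intro v hv
        simp only [mem_sdiff, mem_range, not_lt] at hv
        rw [Nat.choose_eq_zero_of_lt (by lia)]
        simp
      · intro v _
        simp [mul_comm]
    have h5 : (1 + 1 / (2 * (W : ℝ))) ^ W ≤ 2 := by
      have := Real.add_one_le_exp (1 / (2 * (W : ℝ)))
      calc (1 + 1 / (2 * (W : ℝ))) ^ W ≤ Real.exp (1 / (2 * W)) ^ W := by
            gcongr; linarith
        _ = Real.exp (1 / 2) := by
            rw [← Real.exp_nat_mul]; congr 1; field_simp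
        _ ≤ Real.exp (Real.log 2) := by
            gcongr
            have := Real.log_two_gt_d9
            linarith
        _ = 2 := Real.exp_log two_pos
    linarith

open Classical in
/-- The canonical decision tree of a restricted formula bounds its top Fourier coefficient. -/
lemma abs_topCoeff_le_avg_reach (F : DNF n) (C : Finset (Cube n)) (W : ℕ) (U D : Finset (Fin n))
    (x : Cube n) (hDU : Disjoint D U) (hD : ∀ y ∈ cyl U x, F.Reach C W D y)
    (hW : ∀ j, F.Alive U x j → ((F.term j).vars ∩ U).Nonempty → (F.term j).vars.card ≤ W) :
    |topCoeff F.eval U x| ≤ avg U (fun y => if F.Reach C W (D ∪ U) y then 1 else 0) x := by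
  induction hm : U.card using Nat.strong_induction_on generalizing U D x with
  | _ m ih =>
  rcases U.eq_empty_or_nonempty with rfl | ⟨i₀, hi₀⟩
  · have : avg ∅ (fun y => if F.Reach C W (D ∪ ∅) y then (1 : ℝ) else 0) x = 1 := by
      refine (avg_congr fun y hy => ?_).trans (avg_const ∅ 1 x)
      rw [if_pos (by simpa using hD y hy)]
    rw [this]
    exact abs_topCoeff_le_one F.abs_eval_le_one _ _
  have hnn : 0 ≤ avg U (fun y => if F.Reach C W (D ∪ U) y then (1 : ℝ) else 0) x := by
    refine (avg_const U 0 x).symm.le.trans (avg_mono fun y _ => ?_)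
    split_ifs <;> norm_num
  by_cases hex : ∃ j, F.Alive U x j
  swap
  · rw [topCoeff_eval_eq_zero hi₀ fun j hj => absurd ⟨j, hj⟩ hex, abs_zero]
    exact hnn
  obtain ⟨j, hj, hmin⟩ : ∃ j, F.Alive U x j ∧ ∀ i < j, ¬ F.Alive U x i := by
    obtain ⟨j, hj⟩ := exists_minimal_of_wellFoundedLT _ hex
    exact ⟨j, hj.1, fun i hi hi' => absurd (hj.2 hi' hi.le) (not_le_of_gt hi)⟩
  set V := (F.term j).vars ∩ U with hV
  -- An alive term without free variables is satisfied on the whole subcube, where the function is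
  -- then constant.
  rcases V.eq_empty_or_nonempty with hV0 | hVne
  · have hsat : ∀ y ∈ cyl U x, (F.term j).Sat y := by
      obtain ⟨z, hz, hs⟩ := hj
      intro y hy
      refine (F.sat_congr fun i hi => ?_).1 hs
      have hiU : i ∉ U := fun h => by
        have : i ∈ V := mem_inter.2 ⟨hi, h⟩
        simp [hV0] at this
      rw [mem_cyl.1 hz i hiU, mem_cyl.1 hy i hiU]
    rw [topCoeff_eq_zero hi₀, abs_zero]
    · exact hnn
    · intro y hy
      refine eval_congr (iff_of_true ⟨j, hsat _ ?_⟩ ⟨j, hsat y hy⟩)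
      rw [mem_cyl] at hy ⊢
      intro k hk
      rw [Function.update_of_ne (fun he => hk (by rwa [he])), hy k hk]
  have hVU : V ⊆ U := inter_subset_right
  have hdisj : Disjoint V (U \ V) := disjoint_sdiff
  have hUV : V ∪ U \ V = U := union_sdiff_of_subset hVU
  have hDV : Disjoint D V := hDU.mono_right hVU
  have hstep : ∀ y ∈ cyl U x, F.Reach C W (D ∪ V) y := by
    intro y hy
    obtain ⟨z, hz, hs⟩ := hj
    have hy' : V.piecewise z y ∈ cyl U x := by
      rw [mem_cyl]
      intro i hi
      rw [piecewise_eq_of_notMem _ _ _ fun h => hi (hVU h), mem_cyl.1 hy i hi]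
    -- The step starts from `V.piecewise z y`, where `V` is set so as to satisfy term `j`. No
    -- earlier term is alive, so `j` comes first there, and rewriting `V` gives `y`.
    refine Reach.step (j := j) (hD _ hy') ⟨?_, ?_⟩ (hW j ⟨z, hz, hs⟩ hVne) inter_subset_left hVne
      hDV ?_
    · refine (F.sat_congr fun i hi => ?_).1 hs
      by_cases hiV : i ∈ V
      · rw [piecewise_eq_of_mem _ _ _ hiV]
      · have hiU : i ∉ U := fun h => hiV (mem_inter.2 ⟨hi, h⟩)
        rw [piecewise_eq_of_notMem _ _ _ hiV, mem_cyl.1 hz i hiU, mem_cyl.1 hy i hiU]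
    · exact fun i hi hsi => hmin i hi ⟨_, hy', hsi⟩
    · rw [mem_cyl]
      intro i hi
      rw [piecewise_eq_of_notMem _ _ _ hi]
  have hDU' : D ∪ V ∪ U \ V = D ∪ U := by rw [union_assoc, hUV]
  have hcard : (U \ V).card < m := by
    rw [← hm]
    exact card_lt_card (sdiff_ssubset hVU hVne)
  have hrec : ∀ y ∈ cyl V x, |topCoeff F.eval (U \ V) y|
      ≤ avg (U \ V) (fun y => if F.Reach C W (D ∪ U) y then 1 else 0) y := by
    intro y hy
    have hyU : y ∈ cyl U x := cyl_mono hVU x hy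
    rw [← hDU']
    refine ih _ hcard (U \ V) (D ∪ V) y ?_ ?_ ?_ rfl
    · exact disjoint_union_left.2 ⟨hDU.mono_right sdiff_subset, hdisj⟩
    · exact fun z hz => hstep z (mem_cyl_trans sdiff_subset hyU hz)
    · intro i hi hne
      refine hW i ?_ (hne.mono (inter_subset_inter_left sdiff_subset))
      exact (alive_iff_of_mem_cyl hyU).1 (hi.mono (inter_subset_right.trans sdiff_subset))
  calc |topCoeff F.eval U x| = |topCoeff F.eval (V ∪ U \ V) x| := by rw [hUV]
    _ ≤ avg V (fun y => |topCoeff F.eval (U \ V) y|) x := abs_topCoeff_union_le hdisj _ _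
    _ ≤ avg V (avg (U \ V) fun y => if F.Reach C W (D ∪ U) y then 1 else 0) x := avg_mono hrec
    _ = _ := by rw [avg_avg hdisj, hUV]

/-! ### The switching lemma in the presence of long terms -/

open Classical in
/-- The terms of `𝓛` that are alive and query a variable in `U`. -/
def aliveTerms (F : DNF n) (𝓛 : Finset (Fin F.size)) (U : Finset (Fin n)) (x : Cube n) :
    Finset (Fin F.size) :=
  𝓛.filter fun j => F.Alive U x j ∧ ((F.term j).vars ∩ U).Nonempty

lemma aliveTerms_eq_of_mem_cyl {F : DNF n} {𝓛 : Finset (Fin F.size)} {U : Finset (Fin n)}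
    {x y : Cube n} (hy : y ∈ cyl U x) : F.aliveTerms 𝓛 U y = F.aliveTerms 𝓛 U x := by
  classical
  unfold aliveTerms
  refine filter_congr fun j _ => ?_
  rw [alive_iff_of_mem_cyl hy]

-- Once the alive long terms are fixed as `A`, the variables of `U` inside `F.support A` are
-- averaged out by absolute values. An alive term that queries a remaining variable cannot be in
-- `𝓛`, so it is short and the decision tree applies. The aliveness of `A` is recorded in the
-- starting set.
open Classical in
lemma sum_abs_topCoeff_fiber_le (F : DNF n) {X U : Finset (Fin n)} {W : ℕ}
    {𝓛 : Finset (Fin F.size)}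
    (hX : ∀ j, (∃ x, (F.term j).Sat x) → ((F.term j).vars ∩ X).Nonempty →
      (F.term j).vars.card ≤ W ∨ j ∈ 𝓛) (hU : U ⊆ X) (A : Finset (Fin F.size)) :
    ∑ x with F.aliveTerms 𝓛 U x = A, |topCoeff F.eval U x|
      ≤ (univ.filter fun x =>
          F.Reach (F.aliveSet (U ∩ F.support A) A) W (U \ F.support A) x).card := by
  set B := F.support A
  set C := F.aliveSet (U ∩ B) A
  have hdisj : Disjoint (U ∩ B) (U \ B) := (disjoint_sdiff_inter U B).symm
  have hunion : U ∩ B ∪ U \ B = U := by rw [union_comm, sdiff_union_inter]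
  set h : Cube n → ℝ := fun x => if F.aliveTerms 𝓛 U x = A then 1 else 0 with hh
  have h0 : ∀ x, 0 ≤ h x := fun x => by simp only [hh]; split_ifs <;> norm_num
  have hinv : ∀ {V : Finset (Fin n)}, V ⊆ U → ∀ x, ∀ y ∈ cyl V x, h y = h x := by
    intro V hV x y hy
    simp only [hh, aliveTerms_eq_of_mem_cyl (cyl_mono hV x hy)]
  have hR : ∀ x, h x * |topCoeff F.eval (U \ B) x|
      ≤ h x * avg (U \ B) (fun y => if F.Reach C W (U \ B) y then 1 else 0) x := by
    intro x
    by_cases hx : F.aliveTerms 𝓛 U x = A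
    swap
    · simp [hh, hx]
    refine mul_le_mul_of_nonneg_left ?_ (h0 x)
    have := F.abs_topCoeff_le_avg_reach C W (U \ B) ∅ x (disjoint_empty_left _) ?_ ?_
    · simpa only [empty_union] using this
    · intro y hy
      refine Reach.base (mem_aliveSet.2 fun j hj => ?_)
      have hjB : (F.term j).vars ⊆ B :=
        subset_biUnion_of_mem (fun j => (F.term j).vars) hj
      have h1 : F.Alive U x j := (mem_filter.1 (hx ▸ hj : j ∈ F.aliveTerms 𝓛 U x)).2.1
      have h2 : F.Alive U y j := (alive_iff_of_mem_cyl (cyl_mono sdiff_subset x hy)).2 h1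
      exact h2.mono fun i hi => mem_inter.2 ⟨(mem_inter.1 hi).2, hjB (mem_inter.1 hi).1⟩
    · intro j hj hne
      have hjU : F.Alive U x j := hj.mono (inter_subset_right.trans sdiff_subset)
      have hneU := hne.mono (inter_subset_inter_left (sdiff_subset (s := U) (t := B)))
      rcases hX j hjU.exists_sat (hneU.mono (inter_subset_inter_left hU)) with hj' | hj'
      · exact hj'
      · exfalso
        have hjA : j ∈ A := by
          rw [← hx]
          exact mem_filter.2 ⟨hj', hjU, hneU⟩
        obtain ⟨i, hi⟩ := hne
        refine (mem_sdiff.1 (mem_inter.1 hi).2).2 ?_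
        exact mem_biUnion.2 ⟨j, hjA, (mem_inter.1 hi).1⟩
  calc ∑ x with F.aliveTerms 𝓛 U x = A, |topCoeff F.eval U x|
      = ∑ x, h x * |topCoeff F.eval (U ∩ B ∪ U \ B) x| := by
        rw [sum_filter, hunion]
        refine sum_congr rfl fun x _ => ?_
        simp only [hh]; split_ifs <;> simp
    _ ≤ ∑ x, avg (U ∩ B) (fun y => h y * |topCoeff F.eval (U \ B) y|) x := by
        refine sum_le_sum fun x _ => ?_
        rw [avg_mul_left (hinv inter_subset_left x)]
        exact mul_le_mul_of_nonneg_left (abs_topCoeff_union_le hdisj _ _) (h0 x)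
    _ = ∑ x, h x * |topCoeff F.eval (U \ B) x| := sum_avg _ _
    _ ≤ ∑ x, h x * avg (U \ B) (fun y => if F.Reach C W (U \ B) y then 1 else 0) x :=
        sum_le_sum fun x _ => hR x
    _ = ∑ x, avg (U \ B) (fun y => h y * if F.Reach C W (U \ B) y then 1 else 0) x :=
        sum_congr rfl fun x _ => (avg_mul_left (hinv sdiff_subset x)).symm
    _ = ∑ x, h x * (if F.Reach C W (U \ B) x then 1 else 0) := sum_avg _ _
    _ ≤ ∑ x, (if F.Reach C W (U \ B) x then 1 else 0) := by
        refine sum_le_sum fun x _ => ?_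
        simp only [hh]; split_ifs <;> norm_num
    _ = _ := by simp

-- With `V = U ∩ F.support A` fixed, each variable of `V` saves a factor `4 * W` in the count of
-- reachable pairs, and each other variable of the support saves `2` through aliveness. Summing over
-- `V` gives the base `1 / (4 * W) + 1 / 2 ≤ 3 / 4`.
open Classical in
lemma sum_card_reach_le (F : DNF n) {W : ℕ} (hW : 1 ≤ W) (X : Finset (Fin n)) (d : ℕ)
    (A : Finset (Fin F.size)) :
    ∑ U ∈ X.powersetCard d, ((univ.filter fun x =>
        F.Reach (F.aliveSet (U ∩ F.support A) A) W (U \ F.support A) x).card : ℝ)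
      ≤ 2 ^ n * (4 * W) ^ d * (3 / 4) ^ (F.support A).card := by
  set B := F.support A
  have hW' : (1 : ℝ) ≤ W := by exact_mod_cast hW
  have hmaps : ∀ U ∈ X.powersetCard d, U ∩ B ∈ B.powerset :=
    fun U _ => mem_powerset.2 inter_subset_right
  rw [← sum_fiberwise_of_maps_to hmaps]
  have key : ∀ V ∈ B.powerset, ∑ U ∈ X.powersetCard d with U ∩ B = V, ((univ.filter fun x =>
        F.Reach (F.aliveSet (U ∩ B) A) W (U \ B) x).card : ℝ)
      ≤ 2 ^ n * (4 * W) ^ d * ((1 / (4 * W)) ^ V.card * (1 / 2) ^ (B.card - V.card)) := by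
    intro V hV
    rcases (X.powersetCard d |>.filter fun U => U ∩ B = V).eq_empty_or_nonempty with he | ⟨U₀, hU₀⟩
    · rw [he, sum_empty]; positivity
    have hVd : V.card ≤ d := by
      have := mem_filter.1 hU₀
      rw [← (mem_powersetCard.1 this.1).2, ← this.2]
      exact card_le_card inter_subset_left
    have h1 : ∑ U ∈ X.powersetCard d with U ∩ B = V, (univ.filter fun x =>
        F.Reach (F.aliveSet (U ∩ B) A) W (U \ B) x).card
        ≤ (F.reachSet (F.aliveSet V A) W (d - V.card)).card := by
      rw [← card_sigma]
      refine card_le_card_of_injOn (fun p => (p.1 \ B, p.2)) ?_ ?_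
      · rintro ⟨U, x⟩ hp
        obtain ⟨hU, hx⟩ := mem_sigma.1 hp
        obtain ⟨hU, hUV⟩ := mem_filter.1 hU
        simp only at hU hUV hx
        rw [hUV] at hx
        refine mem_reachSet.2 ⟨?_, (mem_filter.1 hx).2⟩
        have h1 := card_sdiff_add_card_inter U B
        have h2 := (mem_powersetCard.1 hU).2
        rw [hUV] at h1
        simp only
        lia
      · rintro ⟨U, x⟩ hp ⟨U', x'⟩ hp' he
        simp only [Prod.mk.injEq] at he
        have h1 := (mem_filter.1 (mem_sigma.1 hp).1).2
        have h2 := (mem_filter.1 (mem_sigma.1 hp').1).2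
        simp only at h1 h2
        have : U = U' := by
          rw [← sdiff_union_inter U B, ← sdiff_union_inter U' B, h1, h2, he.1]
        subst this
        rw [he.2]
    have h2 := F.card_reachSet_le (F.aliveSet V A) hW (d - V.card)
    have h3 := F.card_aliveSet_le V A
    have h4 : (F.support A \ V).card = B.card - V.card :=
      card_sdiff_of_subset (mem_powerset.1 hV)
    rw [h4] at h3
    calc ∑ U ∈ X.powersetCard d with U ∩ B = V, ((univ.filter fun x =>
        F.Reach (F.aliveSet (U ∩ B) A) W (U \ B) x).card : ℝ)
        ≤ (F.reachSet (F.aliveSet V A) W (d - V.card)).card := by exact_mod_cast h1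
      _ ≤ (4 * W) ^ (d - V.card) * (2 ^ n * (1 / 2) ^ (B.card - V.card)) := by
          refine h2.trans ?_
          gcongr
      _ = _ := by
          rw [pow_sub₀ _ (by positivity) hVd, one_div (4 * (W : ℝ)), inv_pow]
          ring
  refine (sum_le_sum key).trans ?_
  rw [← mul_sum, sum_pow_mul_eq_add_pow]
  gcongr
  have : 1 / (4 * (W : ℝ)) ≤ 1 / 4 := by
    rw [div_le_div_iff₀ (by positivity) (by norm_num)]; linarith
  linarith

/-- A switching lemma in which the terms that query a variable in `X` are short, apart from those
in `𝓛`. -/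
theorem sum_powersetCard_fourierCoeff_sq_le (F : DNF n) {X : Finset (Fin n)} {W : ℕ} (hW : 1 ≤ W)
    {𝓛 : Finset (Fin F.size)}
    (hX : ∀ j, (∃ x, (F.term j).Sat x) → ((F.term j).vars ∩ X).Nonempty →
      (F.term j).vars.card ≤ W ∨ j ∈ 𝓛) (d : ℕ) :
    ∑ U ∈ X.powersetCard d, ∑ S with U ⊆ S, fourierCoeff F.eval S ^ 2
      ≤ (4 * W) ^ d * ∑ A ∈ 𝓛.powerset, (3 / 4) ^ (F.support A).card := by
  classical
  have h1 : ∀ U ∈ X.powersetCard d, ∑ S with U ⊆ S, fourierCoeff F.eval S ^ 2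
      ≤ (∑ A ∈ 𝓛.powerset, ((univ.filter fun x =>
        F.Reach (F.aliveSet (U ∩ F.support A) A) W (U \ F.support A) x).card : ℝ)) / 2 ^ n := by
    intro U hU
    refine (sum_superset_fourierCoeff_sq_le _ _).trans ?_
    gcongr
    have hle : ∀ x, topCoeff F.eval U x ^ 2 ≤ |topCoeff F.eval U x| := by
      intro x
      have h := abs_topCoeff_le_one F.abs_eval_le_one U x
      rw [← sq_abs, sq]
      exact mul_le_of_le_one_left (abs_nonneg _) h
    have hmaps : ∀ x ∈ (univ : Finset (Cube n)), F.aliveTerms 𝓛 U x ∈ 𝓛.powerset :=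
      fun x _ => mem_powerset.2 (filter_subset _ _)
    calc ∑ x, topCoeff F.eval U x ^ 2 ≤ ∑ x, |topCoeff F.eval U x| := sum_le_sum fun x _ => hle x
      _ = ∑ A ∈ 𝓛.powerset, ∑ x with F.aliveTerms 𝓛 U x = A, |topCoeff F.eval U x| :=
          (sum_fiberwise_of_maps_to hmaps _).symm
      _ ≤ _ := sum_le_sum fun A _ =>
          F.sum_abs_topCoeff_fiber_le hX (mem_powersetCard.1 hU).1 A
  refine (sum_le_sum h1).trans ?_
  rw [← sum_div, sum_comm, div_le_iff₀ (by positivity), mul_sum, sum_mul]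
  refine sum_le_sum fun A _ => (F.sum_card_reach_le hW X d A).trans (le_of_eq ?_)
  ring

/-- Markov's inequality for the number of `d`-subsets of `S ∩ X`. -/
lemma choose_mul_sum_le (f : Cube n → ℝ) (X : Finset (Fin n)) (d D : ℕ) :
    (D.choose d : ℝ) * ∑ S with D ≤ (S ∩ X).card, fourierCoeff f S ^ 2
      ≤ ∑ U ∈ X.powersetCard d, ∑ S with U ⊆ S, fourierCoeff f S ^ 2 := by
  simp_rw [sum_filter]
  rw [sum_comm, mul_sum]
  refine sum_le_sum fun S _ => ?_
  rw [← sum_filter, sum_const, nsmul_eq_mul]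
  split_ifs with h
  · gcongr
    calc D.choose d ≤ (S ∩ X).card.choose d := Nat.choose_le_choose d h
      _ = ((S ∩ X).powersetCard d).card := (card_powersetCard _ _).symm
      _ ≤ _ := card_le_card fun U hU => by
        obtain ⟨h1, h2⟩ := mem_powersetCard.1 hU
        exact mem_filter.2 ⟨mem_powersetCard.2 ⟨h1.trans inter_subset_right, h2⟩,
          h1.trans inter_subset_left⟩
  · rw [mul_zero]; positivity

end DNF

/-! ### Weight off the empty set, disjoint terms and scarcity of short terms -/

lemma sum_ne_empty_fourierCoeff_sq_le (f : Cube n → ℝ) :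
    ∑ S with S ≠ ∅, fourierCoeff f S ^ 2 ≤ (∑ x, (1 - f x) ^ 2) / 2 ^ n := by
  refine le_trans ?_ (sum_fourierCoeff_sq_le fun x => 1 - f x)
  refine le_trans (le_of_eq ?_)
    (sum_le_sum_of_subset_of_nonneg (filter_subset (fun S => S ≠ ∅) _) fun _ _ _ => sq_nonneg _)
  refine sum_congr rfl fun S hS => ?_
  have h := sum_monomial_mul_monomial (mem_filter.1 hS).2
  simp only [monomial_empty, mul_one] at h
  have : fourierCoeff (fun x => 1 - f x) S = -fourierCoeff f S := by
    unfold fourierCoeff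
    simp_rw [sub_mul, one_mul]
    rw [sum_sub_distrib, h, zero_sub, neg_div]
  rw [this, neg_sq]

lemma card_filter_card_le (B : Finset (Fin n)) (d : ℕ) {c : ℝ} (hc : 0 < c) (hc1 : c ≤ 1) :
    ((B.powerset.filter fun Y => Y.card ≤ d).card : ℝ) ≤ (1 / c) ^ d * (1 + c) ^ B.card := by
  have h1 : ((B.powerset.filter fun Y => Y.card ≤ d).card : ℝ)
      = ∑ Y ∈ B.powerset with Y.card ≤ d, (1 : ℝ) := by simp
  have h2 : ∀ Y ∈ B.powerset.filter (fun Y => Y.card ≤ d), (1 : ℝ)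
      ≤ (1 / c) ^ d * (c ^ Y.card * 1 ^ (B.card - Y.card)) := by
    intro Y hY
    have hd := (mem_filter.1 hY).2
    calc (1 : ℝ) = (1 / c) ^ d * c ^ d := by rw [← mul_pow]; field_simp; simp
      _ ≤ (1 / c) ^ d * (c ^ Y.card * 1 ^ (B.card - Y.card)) := by
        rw [one_pow, mul_one]
        gcongr _ * ?_
        exact pow_le_pow_of_le_one hc.le hc1 hd
  rw [h1]
  refine (sum_le_sum h2).trans ?_
  refine (sum_le_sum_of_subset_of_nonneg (filter_subset _ _) fun _ _ _ => by positivity).trans ?_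
  rw [← mul_sum, sum_pow_mul_eq_add_pow, add_comm]

namespace DNF

lemma sum_ne_empty_le_card (F : DNF n) (Z : Finset (Cube n))
    (hZ : ∀ x, x ∉ Z → ∃ j, (F.term j).Sat x) :
    ∑ S with S ≠ ∅, fourierCoeff F.eval S ^ 2 ≤ Z.card / 2 ^ n := by
  classical
  refine (sum_ne_empty_fourierCoeff_sq_le _).trans ?_
  gcongr
  have : (Z.card : ℝ) = ∑ x, if x ∈ Z then 1 else 0 := by simp
  rw [this]
  refine sum_le_sum fun x _ => ?_
  split_ifs with hx
  · have h0 := F.eval_nonneg x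
    have h1 := F.eval_le_one x
    nlinarith
  · have : F.eval x = 1 := by unfold eval; rw [if_pos (hZ x hx)]
    simp [this]

/-- This is the variance `p - p²` of a Boolean function with mean `p`. -/
lemma sum_ne_empty_le_quarter (F : DNF n) :
    ∑ S with S ≠ ∅, fourierCoeff F.eval S ^ 2 ≤ 1 / 4 := by
  have h := sum_fourierCoeff_sq_le F.eval
  have hsq : ∀ x, F.eval x ^ 2 = F.eval x := by
    intro x; unfold eval; split_ifs <;> norm_num
  simp_rw [hsq] at h
  have he : (∑ x, F.eval x) / 2 ^ n = fourierCoeff F.eval ∅ := by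
    simp [fourierCoeff, monomial_empty]
  rw [he, ← sum_filter_add_sum_filter_not univ (fun S => S ≠ ∅)] at h
  have h2 : ∑ S with ¬ S ≠ ∅, fourierCoeff F.eval S ^ 2 = fourierCoeff F.eval ∅ ^ 2 := by
    rw [show (univ.filter fun S : Finset (Fin n) => ¬ S ≠ ∅) = {∅} by ext; simp, sum_singleton]
  rw [h2] at h
  nlinarith [sq_nonneg (fourierCoeff F.eval ∅ - 1 / 2)]

open Classical in
/-- The satisfiable terms. -/
def satTerms (F : DNF n) : Finset (Fin F.size) := univ.filter fun j => ∃ x, (F.term j).Sat x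

@[simp]
lemma mem_satTerms {F : DNF n} {j : Fin F.size} : j ∈ F.satTerms ↔ ∃ x, (F.term j).Sat x := by
  simp [satTerms]

/-- The terms that query a variable in `B`. -/
def hitting (F : DNF n) (B : Finset (Fin n)) : Finset (Fin F.size) :=
  univ.filter fun j => ((F.term j).vars ∩ B).Nonempty

@[simp]
lemma mem_hitting {F : DNF n} {B : Finset (Fin n)} {j : Fin F.size} :
    j ∈ F.hitting B ↔ ((F.term j).vars ∩ B).Nonempty := by
  simp [hitting]

lemma card_hitting_le {F : DNF n} {k : ℕ} (hk : F.HasRead k) (B : Finset (Fin n)) :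
    (F.hitting B).card ≤ k * B.card := by
  have : F.hitting B ⊆ B.biUnion fun i => univ.filter fun j => i ∈ (F.term j).vars := by
    intro j hj
    obtain ⟨i, hi⟩ := mem_hitting.1 hj
    exact mem_biUnion.2 ⟨i, (mem_inter.1 hi).2, by simpa using (mem_inter.1 hi).1⟩
  rw [mul_comm]
  exact (card_le_card this).trans (card_biUnion_le_card_mul _ _ _ fun i _ => hk i)

lemma sum_card_vars_le {F : DNF n} {k : ℕ} (hk : F.HasRead k) (A : Finset (Fin F.size)) :
    ∑ j ∈ A, (F.term j).vars.card ≤ k * (F.support A).card := by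
  have h : ∀ j ∈ A, (F.term j).vars.card
      = ∑ i ∈ F.support A, if i ∈ (F.term j).vars then 1 else 0 := by
    intro j hj
    rw [← card_filter, filter_mem_eq_inter]
    have : (F.term j).vars ⊆ F.support A := subset_biUnion_of_mem (fun j => (F.term j).vars) hj
    rw [inter_eq_right.2 this]
  rw [sum_congr rfl h, sum_comm, mul_comm]
  refine sum_le_card_nsmul _ _ _ fun i _ => ?_
  rw [← card_filter]
  exact (card_le_card (filter_subset_filter _ (subset_univ A))).trans (hk i)

/-- Double counting of incidences: each variable of the support is counted at most `k` times. -/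
lemma mul_card_le_card_support {F : DNF n} {k m : ℕ} (hk : F.HasRead k) (hk0 : 0 < k)
    {A : Finset (Fin F.size)} (hA : ∀ j ∈ A, k * m ≤ (F.term j).vars.card) :
    m * A.card ≤ (F.support A).card := by
  have h := (card_nsmul_le_sum A _ _ hA).trans (sum_card_vars_le hk A)
  rw [smul_eq_mul] at h
  refine Nat.le_of_mul_le_mul_left ?_ hk0
  calc k * (m * A.card) = A.card * (k * m) := by ring
    _ ≤ _ := h

/-- The terms in `A` query pairwise disjoint sets of variables. -/
def DisjointTerms (F : DNF n) (A : Finset (Fin F.size)) : Prop :=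
  (A : Set (Fin F.size)).PairwiseDisjoint fun j => (F.term j).vars

lemma exists_maximal_disjointTerms (F : DNF n) (A : Finset (Fin F.size))
    (hA : ∀ j ∈ A, (F.term j).vars.Nonempty) :
    ∃ B ⊆ A, F.DisjointTerms B ∧ A ⊆ F.hitting (F.support B) := by
  classical
  obtain ⟨B, hB, hmax⟩ := exists_max_image (A.powerset.filter fun B => F.DisjointTerms B) card
    ⟨∅, mem_filter.2 ⟨by simp, by simp [DisjointTerms]⟩⟩
  obtain ⟨hBA, hdis⟩ := mem_filter.1 hB
  rw [mem_powerset] at hBA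
  refine ⟨B, hBA, hdis, fun j hj => ?_⟩
  rw [mem_hitting]
  by_contra hne
  rw [not_nonempty_iff_eq_empty, ← disjoint_iff_inter_eq_empty] at hne
  have hsub : ∀ i ∈ B, (F.term i).vars ⊆ F.support B := fun i hi =>
    subset_biUnion_of_mem (fun j => (F.term j).vars) hi
  have hjB : j ∉ B := by
    intro h
    obtain ⟨i, hi⟩ := hA j hj
    exact disjoint_left.1 hne hi (hsub j h hi)
  have hins : F.DisjointTerms (insert j B) := by
    unfold DisjointTerms
    rw [coe_insert, Set.pairwiseDisjoint_insert_of_notMem (by exact_mod_cast hjB)]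
    exact ⟨hdis, fun i hi => hne.mono_right (hsub i hi)⟩
  have := hmax _ (mem_filter.2 ⟨mem_powerset.2 (insert_subset hj hBA), hins⟩)
  rw [card_insert_of_notMem hjB] at this
  lia

lemma DisjointTerms.card_support {F : DNF n} {A : Finset (Fin F.size)} (hA : F.DisjointTerms A) :
    (F.support A).card = ∑ j ∈ A, (F.term j).vars.card := card_biUnion hA

-- Terms on disjoint variables are independent, and each is satisfied with probability at least
-- `2^{-u}`.
open Classical in
lemma card_forall_not_sat_le (F : DNF n) {u : ℕ} (A : Finset (Fin F.size)) (hA : F.DisjointTerms A)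
    (hsat : A ⊆ F.satTerms) (hu : ∀ j ∈ A, (F.term j).vars.card ≤ u) :
    ((univ.filter fun x => ∀ j ∈ A, ¬ (F.term j).Sat x).card : ℝ)
      ≤ 2 ^ n * (1 - (1 / 2) ^ u) ^ A.card := by
  induction A using Finset.induction_on with
  | empty => simp
  | insert j A hj ih =>
    have ih := ih (hA.subset (by simp)) ((subset_insert _ _).trans hsat)
      fun i hi => hu i (mem_insert_of_mem hi)
    obtain ⟨z, hz⟩ := mem_satTerms.1 (hsat (mem_insert_self j A))
    set V := (F.term j).vars with hV
    set g : Cube n → ℝ := fun x => if ∀ i ∈ A, ¬ (F.term i).Sat x then 1 else 0 with hg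
    set h : Cube n → ℝ := fun x => if (F.term j).Sat x then 1 else 0 with hh
    have hinv : ∀ x, ∀ y ∈ cyl V x, g y = g x := by
      intro x y hy
      simp only [hg]
      congr 1
      refine propext (forall₂_congr fun i hi => not_congr (F.sat_congr fun v hv => ?_))
      refine mem_cyl.1 hy v fun hvV => ?_
      have hne : i ≠ j := fun h => hj (h ▸ hi)
      exact disjoint_left.1 (hA (mem_insert_of_mem hi) (mem_insert_self j A) hne) hv hvV
    have havg : ∀ x, (1 / 2) ^ u ≤ avg V h x := by
      intro x
      have hmem : V.piecewise z x ∈ cyl V x := by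
        rw [mem_cyl]
        exact fun i hi => piecewise_eq_of_notMem _ _ _ hi
      have hs : (F.term j).Sat (V.piecewise z x) :=
        (F.sat_congr fun i hi => (piecewise_eq_of_mem _ _ _ hi).symm).1 hz
      have h1 : (1 : ℝ) ≤ ∑ y ∈ cyl V x, h y := by
        refine le_trans (by simp [hh, hs]) (single_le_sum (f := h) (fun y _ => ?_) hmem)
        simp only [hh]; split_ifs <;> norm_num
      calc ((1 : ℝ) / 2) ^ u ≤ (1 / 2) ^ V.card :=
            pow_le_pow_of_le_one (by norm_num) (by norm_num) (hu j (mem_insert_self _ _))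
        _ = 1 / 2 ^ V.card := by simp
        _ ≤ avg V h x := by unfold avg; gcongr
    have hcard : ((univ.filter fun x => ∀ i ∈ A, ¬ (F.term i).Sat x).card : ℝ) = ∑ x, g x := by
      simp [hg]
    have hcard' : ((univ.filter fun x => ∀ i ∈ insert j A, ¬ (F.term i).Sat x).card : ℝ)
        = ∑ x, (g x - g x * h x) := by
      rw [card_filter]
      push_cast
      refine sum_congr rfl fun x _ => ?_
      simp only [hg, hh, forall_mem_insert]
      by_cases h1 : (F.term j).Sat x <;> by_cases h2 : ∀ i ∈ A, ¬ (F.term i).Sat x <;>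
        simp [h1, h2]
    have hg0 : ∀ x, 0 ≤ g x := fun x => by simp only [hg]; split_ifs <;> norm_num
    have h1u : ((1 : ℝ) / 2) ^ u ≤ 1 := pow_le_one₀ (by norm_num) (by norm_num)
    rw [hcard', sum_sub_distrib, ← sum_avg V fun x => g x * h x, card_insert_of_notMem hj]
    calc ∑ x, g x - ∑ x, avg V (fun y => g y * h y) x
        ≤ ∑ x, g x - ∑ x, g x * (1 / 2) ^ u := by
          gcongr with x
          rw [avg_mul_left (hinv x)]
          exact mul_le_mul_of_nonneg_left (havg x) (hg0 x)
      _ = (∑ x, g x) * (1 - (1 / 2) ^ u) := by rw [← sum_mul]; ring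
      _ ≤ (2 ^ n * (1 - (1 / 2) ^ u) ^ A.card) * (1 - (1 / 2) ^ u) := by
          rw [← hcard]
          gcongr
      _ = _ := by ring

/-- A formula with many short terms is nearly constant. -/
theorem nearly_const_or_few_terms {F : DNF n} {k : ℕ} (hk : F.HasRead k) (τ : ℕ) :
    ∑ S with S ≠ ∅, fourierCoeff F.eval S ^ 2 ≤ (1 / 2) ^ τ ∨
      (∀ j ∈ F.satTerms, (F.term j).vars.Nonempty) ∧
      ∀ u, (F.satTerms.filter fun j => (F.term j).vars.card ≤ u).card ≤ k * (u * (2 ^ u * τ)) := by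
  classical
  by_cases hne : ∀ j ∈ F.satTerms, (F.term j).vars.Nonempty
  swap
  · push Not at hne
    obtain ⟨j, hj, hempty⟩ := hne
    left
    obtain ⟨z, hz⟩ := mem_satTerms.1 hj
    refine (F.sum_ne_empty_le_card ∅ fun x _ => ⟨j, ?_⟩).trans (by simp)
    exact (F.sat_congr fun i hi => by simp [hempty] at hi).1 hz
  by_cases hfew : ∀ u, (F.satTerms.filter fun j => (F.term j).vars.card ≤ u).card
      ≤ k * (u * (2 ^ u * τ))
  · exact Or.inr ⟨hne, hfew⟩
  left
  push Not at hfew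
  obtain ⟨u, hu⟩ := hfew
  obtain ⟨A, hA, hdis, hhit⟩ := F.exists_maximal_disjointTerms
    (F.satTerms.filter fun j => (F.term j).vars.card ≤ u) fun j hj => hne j (mem_filter.1 hj).1
  have hAu : ∀ j ∈ A, (F.term j).vars.card ≤ u := fun j hj => (mem_filter.1 (hA hj)).2
  -- By maximality every short term meets the support of `A`, which has at most `u * A.card`
  -- variables, each in at most `k` terms.
  have hcard : 2 ^ u * τ ≤ A.card := by
    by_contra hlt
    push Not at hlt
    refine absurd hu (not_lt.2 ?_)
    refine (card_le_card hhit).trans ((card_hitting_le hk _).trans ?_)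
    gcongr
    rw [hdis.card_support]
    refine (sum_le_card_nsmul _ _ _ hAu).trans ?_
    rw [smul_eq_mul, mul_comm]
    gcongr
  have h1 := F.card_forall_not_sat_le A hdis (hA.trans (filter_subset _ _)) hAu
  refine (F.sum_ne_empty_le_card _ fun x hx => ?_).trans
    ((div_le_iff₀ (by positivity)).2 (h1.trans ?_))
  · simp only [mem_filter, mem_univ, true_and, not_forall, not_not] at hx
    obtain ⟨j, _, hj⟩ := hx
    exact ⟨j, hj⟩
  rw [mul_comm]
  gcongr
  have h0 : (0 : ℝ) ≤ 1 - (1 / 2) ^ u := by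
    have : ((1 : ℝ) / 2) ^ u ≤ 1 := pow_le_one₀ (by norm_num) (by norm_num)
    linarith
  calc (1 - (1 / 2 : ℝ) ^ u) ^ A.card ≤ (1 - (1 / 2 : ℝ) ^ u) ^ (2 ^ u * τ) :=
        pow_le_pow_of_le_one h0 (by linarith [pow_pos (by norm_num : (0 : ℝ) < 1 / 2) u]) hcard
    _ ≤ (Real.exp (-(1 / 2) ^ u)) ^ (2 ^ u * τ) := by
        gcongr
        linarith [Real.add_one_le_exp (-(1 / 2 : ℝ) ^ u)]
    _ = (Real.exp (-1)) ^ τ := by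
        rw [pow_mul, ← Real.exp_nat_mul]
        congr 2
        push_cast
        rw [mul_neg, ← mul_pow]
        norm_num
    _ ≤ (1 / 2) ^ τ := by
        gcongr
        have := Real.exp_one_gt_d9
        rw [Real.exp_neg, ← one_div]
        exact one_div_le_one_div_of_le two_pos (by linarith)

/-! ### Sums over families of long terms -/

lemma one_add_pow_le_exp {c : ℝ} (hc : 0 ≤ c) (m : ℕ) : (1 + c) ^ m ≤ Real.exp (m * c) := by
  rw [Real.exp_nat_mul]
  gcongr
  linarith [Real.add_one_le_exp c]

lemma sum_pow_card_support_le {F : DNF n} {k m : ℕ} (hk : F.HasRead k) (hk0 : 0 < k)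
    {𝓛 : Finset (Fin F.size)} (h𝓛 : ∀ j ∈ 𝓛, k * m ≤ (F.term j).vars.card) {c : ℝ} (hc : 0 < c)
    (hc1 : c ≤ 1) :
    ∑ A ∈ 𝓛.powerset, c ^ (F.support A).card ≤ (1 + c ^ m) ^ 𝓛.card := by
  calc ∑ A ∈ 𝓛.powerset, c ^ (F.support A).card
      ≤ ∑ A ∈ 𝓛.powerset, (c ^ m) ^ A.card * 1 ^ (𝓛.card - A.card) := by
        refine sum_le_sum fun A hA => ?_
        rw [one_pow, mul_one, ← pow_mul]
        exact pow_le_pow_of_le_one hc.le hc1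
          (mul_card_le_card_support hk hk0 fun j hj => h𝓛 j (mem_powerset.1 hA hj))
    _ = (1 + c ^ m) ^ 𝓛.card := by rw [sum_pow_mul_eq_add_pow, add_comm]

/-- Families are grouped by a maximal disjoint subfamily `B`, whose support has `q` variables; the
other members lie among the at most `k * q` terms that meet this support. In the split `1/3 =
(2/5)(5/6)`, the factor `2/5` pays for `B`, and `5/6` pays for the choice of members at a cost of at
most `(10/9)^q`. The result `4/9` is below `1/2`, which is needed to beat `2^u` terms of width `u`.
-/
lemma sum_third_pow_card_support_le {F : DNF n} {k l : ℕ} (hk : F.HasRead k) (hk0 : 0 < k)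
    (hl : (k : ℝ) * (5 / 6) ^ l ≤ 1 / 10) {𝓑 : Finset (Fin F.size)}
    (h𝓑 : ∀ j ∈ 𝓑, k * l ≤ (F.term j).vars.card) (hne : ∀ j ∈ 𝓑, (F.term j).vars.Nonempty) :
    ∑ A ∈ 𝓑.powerset, (1 / 3 : ℝ) ^ (F.support A).card
      ≤ Real.exp (∑ j ∈ 𝓑, (4 / 9) ^ (F.term j).vars.card) := by
  classical
  have hex : ∀ A : Finset (Fin F.size), ∃ B, A ⊆ 𝓑 →
      B ⊆ A ∧ F.DisjointTerms B ∧ A ⊆ F.hitting (F.support B) := by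
    intro A
    by_cases hA : A ⊆ 𝓑
    · obtain ⟨B, hB⟩ := F.exists_maximal_disjointTerms A fun j hj => hne j (hA hj)
      exact ⟨B, fun _ => hB⟩
    · exact ⟨∅, fun h => absurd h hA⟩
  choose core hcore using hex
  have hmaps : ∀ A ∈ 𝓑.powerset, core A ∈ 𝓑.powerset := fun A hA =>
    mem_powerset.2 ((hcore A (mem_powerset.1 hA)).1.trans (mem_powerset.1 hA))
  have hfib : ∀ B ∈ 𝓑.powerset, ∑ A ∈ 𝓑.powerset with core A = B,
      (1 / 3 : ℝ) ^ (F.support A).card ≤ ∏ j ∈ B, (4 / 9) ^ (F.term j).vars.card := by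
    intro B _
    rcases (𝓑.powerset.filter fun A => core A = B).eq_empty_or_nonempty with he | ⟨A₀, hA₀⟩
    · rw [he, sum_empty]; positivity
    obtain ⟨hA₀, hB⟩ := mem_filter.1 hA₀
    set q := (F.support B).card with hq
    have hdis : F.DisjointTerms B := hB ▸ (hcore A₀ (mem_powerset.1 hA₀)).2.1
    rw [prod_pow_eq_pow_sum, ← hdis.card_support, ← hq]
    have hsub : (𝓑.powerset.filter fun A => core A = B) ⊆ (F.hitting (F.support B)).powerset := by
      intro A hA
      obtain ⟨hA, hAB⟩ := mem_filter.1 hA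
      rw [← hAB]
      exact mem_powerset.2 (hcore A (mem_powerset.1 hA)).2.2
    have hterm : ∀ A ∈ 𝓑.powerset.filter fun A => core A = B,
        (1 / 3 : ℝ) ^ (F.support A).card
          ≤ (2 / 5) ^ q * (((5 / 6) ^ l) ^ A.card * 1 ^ ((F.hitting (F.support B)).card - A.card)) := by
      intro A hA
      obtain ⟨hA, hAB⟩ := mem_filter.1 hA
      have hA := mem_powerset.1 hA
      have h1 : q ≤ (F.support A).card := by
        rw [hq, ← hAB]
        exact card_le_card (biUnion_subset_biUnion_of_subset_left _ (hcore A hA).1)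
      have h2 : l * A.card ≤ (F.support A).card :=
        mul_card_le_card_support hk hk0 fun j hj => h𝓑 j (hA hj)
      calc (1 / 3 : ℝ) ^ (F.support A).card
          = (2 / 5) ^ (F.support A).card * (5 / 6) ^ (F.support A).card := by
            rw [← mul_pow]; norm_num
        _ ≤ (2 / 5) ^ q * (5 / 6) ^ (l * A.card) :=
            mul_le_mul (pow_le_pow_of_le_one (by norm_num) (by norm_num) h1)
              (pow_le_pow_of_le_one (by norm_num) (by norm_num) h2) (by positivity)
              (by positivity)
        _ = _ := by rw [one_pow, mul_one, pow_mul]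
    calc ∑ A ∈ 𝓑.powerset with core A = B, (1 / 3 : ℝ) ^ (F.support A).card
        ≤ ∑ A ∈ (F.hitting (F.support B)).powerset, (2 / 5) ^ q *
            (((5 / 6) ^ l) ^ A.card * 1 ^ ((F.hitting (F.support B)).card - A.card)) :=
          (sum_le_sum hterm).trans
            (sum_le_sum_of_subset_of_nonneg hsub fun _ _ _ => by positivity)
      _ = (2 / 5) ^ q * (1 + (5 / 6) ^ l) ^ (F.hitting (F.support B)).card := by
          rw [← mul_sum, sum_pow_mul_eq_add_pow, add_comm]
      _ ≤ (2 / 5) ^ q * Real.exp (q * Real.log (10 / 9)) := by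
          gcongr
          refine (one_add_pow_le_exp (by positivity) _).trans (Real.exp_le_exp.2 ?_)
          have h1 : ((F.hitting (F.support B)).card : ℝ) ≤ k * q := by
            exact_mod_cast card_hitting_le hk _
          have h2 : (1 / 10 : ℝ) ≤ Real.log (10 / 9) := by
            have := Real.one_sub_inv_le_log_of_pos (by norm_num : (0 : ℝ) < 10 / 9)
            norm_num at this ⊢
            linarith
          calc ((F.hitting (F.support B)).card : ℝ) * (5 / 6) ^ l ≤ (k * q) * (5 / 6) ^ l := by
                gcongr
            _ = q * (k * (5 / 6) ^ l) := by ring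
            _ ≤ q * Real.log (10 / 9) := by
                gcongr
                linarith
      _ = (4 / 9) ^ q := by
          rw [Real.exp_nat_mul, Real.exp_log (by norm_num), ← mul_pow]
          norm_num
  calc ∑ A ∈ 𝓑.powerset, (1 / 3 : ℝ) ^ (F.support A).card
      = ∑ B ∈ 𝓑.powerset, ∑ A ∈ 𝓑.powerset with core A = B,
          (1 / 3 : ℝ) ^ (F.support A).card := (sum_fiberwise_of_maps_to hmaps _).symm
    _ ≤ ∑ B ∈ 𝓑.powerset, ∏ j ∈ B, (4 / 9) ^ (F.term j).vars.card := sum_le_sum hfib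
    _ = ∏ j ∈ 𝓑, (1 + (4 / 9) ^ (F.term j).vars.card) := (prod_one_add _).symm
    _ ≤ ∏ j ∈ 𝓑, Real.exp ((4 / 9) ^ (F.term j).vars.card) := by
        refine prod_le_prod (fun _ _ => by positivity) fun j _ => ?_
        linarith [Real.add_one_le_exp ((4 / 9 : ℝ) ^ (F.term j).vars.card)]
    _ = _ := (Real.exp_sum _ _).symm

/-! ### Bounding coefficients by covers -/

open Classical in
/-- The families of terms in `𝓑` that cover `Y` and all of whose members query a variable
in `Y`. -/
def covers (F : DNF n) (𝓑 : Finset (Fin F.size)) (Y : Finset (Fin n)) :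
    Finset (Finset (Fin F.size)) :=
  (𝓑 ∩ F.hitting Y).powerset.filter fun A => Y ⊆ F.support A

lemma mem_covers {F : DNF n} {𝓑 A : Finset (Fin F.size)} {Y : Finset (Fin n)} :
    A ∈ F.covers 𝓑 Y ↔ (A ⊆ 𝓑 ∧ A ⊆ F.hitting Y) ∧ Y ⊆ F.support A := by
  rw [covers, mem_filter, mem_powerset, subset_inter_iff]

/-- If the top coefficient at `x` is nonzero, each variable of `S` lies in an alive term. The alive
terms that meet `S \ X` then form a cover of it, and the sum counts that cover. -/
lemma abs_fourierCoeff_le_sum_covers (F : DNF n) {X : Finset (Fin n)} {𝓑 : Finset (Fin F.size)}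
    (hX : ∀ j ∈ F.satTerms, ¬ (F.term j).vars ⊆ X → j ∈ 𝓑) (S : Finset (Fin n)) :
    |fourierCoeff F.eval S|
      ≤ ∑ A ∈ F.covers 𝓑 (S \ X), (1 / 2) ^ (F.support A).card * 2 ^ S.card := by
  classical
  have h1 : ∀ x, |topCoeff F.eval S x|
      ≤ ∑ A ∈ F.covers 𝓑 (S \ X), if x ∈ F.aliveSet S A then (1 : ℝ) else 0 := by
    intro x
    have hnn : ∀ A ∈ F.covers 𝓑 (S \ X), (0 : ℝ) ≤ if x ∈ F.aliveSet S A then 1 else 0 := by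
      intro A _; split_ifs <;> norm_num
    set A := univ.filter fun j => F.Alive S x j ∧ ((F.term j).vars ∩ (S \ X)).Nonempty with hA
    by_cases hcov : S \ X ⊆ F.support A
    · have hmem : A ∈ F.covers 𝓑 (S \ X) := by
        refine mem_covers.2 ⟨⟨fun j hj => ?_, fun j hj => ?_⟩, hcov⟩
        · obtain ⟨h2, i, hi⟩ := (mem_filter.1 hj).2
          refine hX j (mem_satTerms.2 h2.exists_sat) fun hsub => ?_
          exact (mem_sdiff.1 (mem_inter.1 hi).2).2 (hsub (mem_inter.1 hi).1)
        · exact mem_hitting.2 (mem_filter.1 hj).2.2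
      refine le_trans ?_ (single_le_sum hnn hmem)
      rw [if_pos (mem_aliveSet.2 fun j hj => (mem_filter.1 hj).2.1)]
      exact abs_topCoeff_le_one F.abs_eval_le_one _ _
    · obtain ⟨i, hi, hiA⟩ := not_subset.1 hcov
      rw [topCoeff_eval_eq_zero (mem_sdiff.1 hi).1, abs_zero]
      · exact sum_nonneg hnn
      · intro j hj hij
        refine hiA (mem_biUnion.2 ⟨j, mem_filter.2 ⟨mem_univ _, hj, i, ?_⟩, hij⟩)
        exact mem_inter.2 ⟨hij, hi⟩
  rw [fourierCoeff_eq_sum_topCoeff, abs_div, abs_of_pos (by positivity : (0 : ℝ) < 2 ^ n),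
    div_le_iff₀ (by positivity)]
  refine (abs_sum_le_sum_abs _ _).trans ((sum_le_sum fun x _ => h1 x).trans ?_)
  rw [sum_comm, sum_mul]
  refine sum_le_sum fun A _ => ?_
  rw [sum_boole, filter_mem_eq_inter, univ_inter]
  refine (F.card_aliveSet_le S A).trans ?_
  have h2 : (F.support A).card ≤ (F.support A \ S).card + S.card := by
    have := le_card_sdiff S (F.support A)
    lia
  calc (2 : ℝ) ^ n * (1 / 2) ^ (F.support A \ S).card
      = 2 ^ n * ((1 / 2) ^ ((F.support A \ S).card + S.card) * 2 ^ S.card) := by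
        rw [pow_add, mul_assoc, ← mul_pow]; norm_num
    _ ≤ 2 ^ n * ((1 / 2) ^ (F.support A).card * 2 ^ S.card) := by
        gcongr _ * (?_ * _)
        exact pow_le_pow_of_le_one (by norm_num) (by norm_num) h2
    _ = _ := by ring

/-- Since `8/9 ≤ (19/20)²`, one factor `19/20` per variable of the support gains `e^{-|Y|/20}`, and
the other weights the choice among the at most `k * Y.card` terms that meet `Y`, which costs at most
`e^{|Y|/20}`. -/
lemma sum_covers_le_one {F : DNF n} {k l : ℕ} (hk : F.HasRead k) (hk0 : 0 < k)
    (hl : (k : ℝ) * (19 / 20) ^ l ≤ 1 / 20) {𝓑 : Finset (Fin F.size)}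
    (h𝓑 : ∀ j ∈ 𝓑, k * l ≤ (F.term j).vars.card) (Y : Finset (Fin n)) :
    ∑ A ∈ F.covers 𝓑 Y, (8 / 9 : ℝ) ^ (F.support A).card ≤ 1 := by
  classical
  have hterm : ∀ A ∈ F.covers 𝓑 Y, (8 / 9 : ℝ) ^ (F.support A).card
      ≤ (19 / 20) ^ Y.card * (((19 / 20) ^ l) ^ A.card * 1 ^ ((F.hitting Y).card - A.card)) := by
    intro A hA
    obtain ⟨⟨hA𝓑, _⟩, hYA⟩ := mem_covers.1 hA
    have h1 := card_le_card hYA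
    have h2 : l * A.card ≤ (F.support A).card :=
      mul_card_le_card_support hk hk0 fun j hj => h𝓑 j (hA𝓑 hj)
    calc (8 / 9 : ℝ) ^ (F.support A).card ≤ (19 / 20 * (19 / 20)) ^ (F.support A).card := by
          gcongr; norm_num
      _ = (19 / 20) ^ (F.support A).card * (19 / 20) ^ (F.support A).card := mul_pow _ _ _
      _ ≤ (19 / 20) ^ Y.card * (19 / 20) ^ (l * A.card) :=
          mul_le_mul (pow_le_pow_of_le_one (by norm_num) (by norm_num) h1)
            (pow_le_pow_of_le_one (by norm_num) (by norm_num) h2) (by positivity) (by positivity)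
      _ = _ := by rw [one_pow, mul_one, pow_mul]
  have hsub : F.covers 𝓑 Y ⊆ (F.hitting Y).powerset := fun A hA =>
    mem_powerset.2 (mem_covers.1 hA).1.2
  refine (sum_le_sum hterm).trans
    ((sum_le_sum_of_subset_of_nonneg hsub fun _ _ _ => by positivity).trans ?_)
  rw [← mul_sum, sum_pow_mul_eq_add_pow, add_comm]
  have hcard : ((F.hitting Y).card : ℝ) ≤ k * Y.card := by exact_mod_cast card_hitting_le hk Y
  calc (19 / 20 : ℝ) ^ Y.card * (1 + (19 / 20) ^ l) ^ (F.hitting Y).card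
      ≤ (Real.exp (-(1 / 20))) ^ Y.card * Real.exp ((F.hitting Y).card * (19 / 20) ^ l) := by
        gcongr
        · linarith [Real.add_one_le_exp (-(1 / 20 : ℝ))]
        · exact one_add_pow_le_exp (by positivity) _
    _ ≤ (Real.exp (-(1 / 20))) ^ Y.card * Real.exp (Y.card * (1 / 20)) := by
        gcongr _ * ?_
        refine Real.exp_le_exp.2 ?_
        calc ((F.hitting Y).card : ℝ) * (19 / 20) ^ l ≤ (k * Y.card) * (19 / 20) ^ l := by gcongr
          _ = Y.card * (k * (19 / 20) ^ l) := by ring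
          _ ≤ Y.card * (1 / 20) := by gcongr
    _ = 1 := by
        rw [← Real.exp_nat_mul, ← Real.exp_add, mul_neg, neg_add_cancel, Real.exp_zero]

/-- Cauchy–Schwarz with the weights `(8/9)^|supp A|`, whose sum is at most 1; the new base is `(1/4)
/ (8/9) = 9/32`. -/
lemma fourierCoeff_sq_le_sum_covers {F : DNF n} {k l : ℕ} (hk : F.HasRead k) (hk0 : 0 < k)
    (hl : (k : ℝ) * (19 / 20) ^ l ≤ 1 / 20) {X : Finset (Fin n)} {𝓑 : Finset (Fin F.size)}
    (h𝓑 : ∀ j ∈ 𝓑, k * l ≤ (F.term j).vars.card)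
    (hX : ∀ j ∈ F.satTerms, ¬ (F.term j).vars ⊆ X → j ∈ 𝓑) (S : Finset (Fin n)) :
    fourierCoeff F.eval S ^ 2
      ≤ ∑ A ∈ F.covers 𝓑 (S \ X), (9 / 32) ^ (F.support A).card * 4 ^ S.card := by
  have h1 := F.abs_fourierCoeff_le_sum_covers hX S
  have h2 := sum_covers_le_one hk hk0 hl h𝓑 (S \ X)
  have h3 := sum_sq_le_sum_mul_sum_of_sq_le_mul (F.covers 𝓑 (S \ X))
    (r := fun A => (1 / 2 : ℝ) ^ (F.support A).card * 2 ^ S.card)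
    (f := fun A => (8 / 9 : ℝ) ^ (F.support A).card)
    (g := fun A => (9 / 32 : ℝ) ^ (F.support A).card * 4 ^ S.card)
    (fun _ _ => by positivity) (fun _ _ => by positivity) fun A _ => by
      refine le_of_eq ?_
      rw [mul_pow, ← pow_mul, ← pow_mul, mul_comm _ 2, mul_comm _ 2, pow_mul, pow_mul,
        ← mul_assoc, ← mul_pow]
      norm_num
  rw [← sq_abs]
  calc |fourierCoeff F.eval S| ^ 2
      ≤ (∑ A ∈ F.covers 𝓑 (S \ X), (1 / 2 : ℝ) ^ (F.support A).card * 2 ^ S.card) ^ 2 := by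
        gcongr
    _ ≤ _ := h3
    _ ≤ _ := mul_le_of_le_one_left (sum_nonneg fun _ _ => by positivity) h2

/-! ### The family of covered sets: its size and the weight outside it -/

open Classical in
/-- The sets `S` for which `S ∩ X` lies in `𝓜` and `S \ X` is covered by terms in `𝓑` that query
at most `q` variables in all. -/
def coveredSets (F : DNF n) (X : Finset (Fin n)) (𝓑 : Finset (Fin F.size))
    (𝓜 : Finset (Finset (Fin n))) (q : ℕ) : Finset (Finset (Fin n)) :=
  univ.filter fun S => S ∩ X ∈ 𝓜 ∧
    ∃ A ⊆ 𝓑, S \ X ⊆ F.support A ∧ (F.support A).card ≤ q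

lemma card_coveredSets_le (F : DNF n) (X : Finset (Fin n)) (𝓑 : Finset (Fin F.size))
    (𝓜 : Finset (Finset (Fin n))) (q : ℕ) :
    ((F.coveredSets X 𝓑 𝓜 q).card : ℝ)
      ≤ 𝓜.card * 6 ^ q * ∑ A ∈ 𝓑.powerset, (1 / 3 : ℝ) ^ (F.support A).card := by
  classical
  set 𝓐 := 𝓑.powerset.filter fun A => (F.support A).card ≤ q
  have h1 : F.coveredSets X 𝓑 𝓜 q
      ⊆ 𝓐.biUnion fun A => (𝓜 ×ˢ (F.support A).powerset).image fun p => p.1 ∪ p.2 := by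
    intro S hS
    obtain ⟨hM, A, hA, hcov, hq⟩ := (mem_filter.1 hS).2
    refine mem_biUnion.2 ⟨A, mem_filter.2 ⟨mem_powerset.2 hA, hq⟩,
      mem_image.2 ⟨(S ∩ X, S \ X), mem_product.2 ⟨hM, mem_powerset.2 hcov⟩, ?_⟩⟩
    rw [union_comm, sdiff_union_inter]
  have h2 : (F.coveredSets X 𝓑 𝓜 q).card ≤ ∑ A ∈ 𝓐, 𝓜.card * 2 ^ (F.support A).card := by
    refine (card_le_card h1).trans (card_biUnion_le.trans (sum_le_sum fun A _ => ?_))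
    refine card_image_le.trans ?_
    rw [card_product, card_powerset]
  calc ((F.coveredSets X 𝓑 𝓜 q).card : ℝ)
      ≤ ∑ A ∈ 𝓐, (𝓜.card : ℝ) * 2 ^ (F.support A).card := by exact_mod_cast h2
    _ ≤ ∑ A ∈ 𝓐, (𝓜.card : ℝ) * 6 ^ q * (1 / 3) ^ (F.support A).card := by
        refine sum_le_sum fun A hA => ?_
        rw [mul_assoc]
        gcongr
        calc (2 : ℝ) ^ (F.support A).card
            = 6 ^ (F.support A).card * (1 / 3) ^ (F.support A).card := by
              rw [← mul_pow]; norm_num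
          _ ≤ _ := by
              gcongr
              · norm_num
              · exact (mem_filter.1 hA).2
    _ ≤ ∑ A ∈ 𝓑.powerset, (𝓜.card : ℝ) * 6 ^ q * (1 / 3) ^ (F.support A).card :=
        sum_le_sum_of_subset_of_nonneg (filter_subset _ _) fun _ _ _ => by positivity
    _ = _ := by rw [mul_sum]

/-- Every cover of an uncovered `S \ X` has a support of at least `q` variables. For given `A`, at
most `𝓜.card * 16 ^ d * (17/16) ^ |supp A|` sets `S` occur. As `(17/16)(9/32) ≤ (9/10)(1/3)`, the
factor `9/10` yields the decay in `q` and `1/3` stays in the sum. -/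
theorem sum_not_covered_le {F : DNF n} {k l : ℕ} (hk : F.HasRead k) (hk0 : 0 < k)
    (hl : (k : ℝ) * (19 / 20) ^ l ≤ 1 / 20) {X : Finset (Fin n)} {𝓑 : Finset (Fin F.size)}
    (h𝓑 : ∀ j ∈ 𝓑, k * l ≤ (F.term j).vars.card)
    (hX : ∀ j ∈ F.satTerms, ¬ (F.term j).vars ⊆ X → j ∈ 𝓑) (𝓜 : Finset (Finset (Fin n)))
    (d q : ℕ) :
    ∑ S with (S.card ≤ d ∧ S ∩ X ∈ 𝓜) ∧ S ∉ F.coveredSets X 𝓑 𝓜 q, fourierCoeff F.eval S ^ 2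
      ≤ 64 ^ d * 𝓜.card * (9 / 10) ^ q * ∑ A ∈ 𝓑.powerset, (1 / 3 : ℝ) ^ (F.support A).card := by
  classical
  set bad := univ.filter fun S => (S.card ≤ d ∧ S ∩ X ∈ 𝓜) ∧ S ∉ F.coveredSets X 𝓑 𝓜 q
  have h1 : ∀ S ∈ bad, fourierCoeff F.eval S ^ 2
      ≤ ∑ A ∈ 𝓑.powerset, if q ≤ (F.support A).card ∧ S \ X ⊆ F.support A then
        (9 / 32 : ℝ) ^ (F.support A).card * 4 ^ d else 0 := by
    intro S hS
    obtain ⟨⟨hd, hM⟩, hnc⟩ := (mem_filter.1 hS).2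
    refine (fourierCoeff_sq_le_sum_covers hk hk0 hl h𝓑 hX S).trans ?_
    rw [← sum_filter]
    refine le_trans (sum_le_sum fun A _ => ?_)
      (sum_le_sum_of_subset_of_nonneg (?_ : F.covers 𝓑 (S \ X) ⊆ _) fun _ _ _ => by positivity)
    · gcongr
      norm_num
    · intro A hA
      obtain ⟨⟨hA𝓑, _⟩, hcov⟩ := mem_covers.1 hA
      refine mem_filter.2 ⟨mem_powerset.2 hA𝓑, ?_, hcov⟩
      by_contra hq
      exact hnc (mem_filter.2 ⟨mem_univ _, hM, A, hA𝓑, hcov, by lia⟩)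
  refine (sum_le_sum h1).trans ?_
  rw [sum_comm, mul_sum]
  refine sum_le_sum fun A _ => ?_
  rw [← sum_filter, sum_const, nsmul_eq_mul]
  by_cases hq : q ≤ (F.support A).card
  swap
  · simp only [hq, false_and, filter_false, card_empty, Nat.cast_zero, zero_mul]
    positivity
  have h2 : ((bad.filter fun S => q ≤ (F.support A).card ∧ S \ X ⊆ F.support A).card : ℝ)
      ≤ 𝓜.card * (16 ^ d * (17 / 16) ^ (F.support A).card) := by
    have hsub : (bad.filter fun S => q ≤ (F.support A).card ∧ S \ X ⊆ F.support A)
        ⊆ (𝓜 ×ˢ (F.support A).powerset.filter fun Y => Y.card ≤ d).image fun p => p.1 ∪ p.2 := by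
      intro S hS
      obtain ⟨hbad, _, hcov⟩ := mem_filter.1 hS
      obtain ⟨⟨hd, hM⟩, _⟩ := (mem_filter.1 hbad).2
      refine mem_image.2 ⟨(S ∩ X, S \ X), mem_product.2 ⟨hM, mem_filter.2
        ⟨mem_powerset.2 hcov, (card_le_card sdiff_subset).trans hd⟩⟩, ?_⟩
      rw [union_comm, sdiff_union_inter]
    have h3 := card_filter_card_le (F.support A) d (c := 1 / 16) (by norm_num) (by norm_num)
    have h4 := (card_le_card hsub).trans card_image_le
    rw [card_product] at h4
    calc ((bad.filter fun S => q ≤ (F.support A).card ∧ S \ X ⊆ F.support A).card : ℝ)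
        ≤ 𝓜.card * ((F.support A).powerset.filter fun Y => Y.card ≤ d).card := by
          exact_mod_cast h4
      _ ≤ 𝓜.card * ((1 / (1 / 16)) ^ d * (1 + 1 / 16) ^ (F.support A).card) := by gcongr
      _ = _ := by norm_num
  calc _ ≤ (𝓜.card : ℝ) * (16 ^ d * (17 / 16) ^ (F.support A).card)
        * ((9 / 32) ^ (F.support A).card * 4 ^ d) := by gcongr
    _ = (16 ^ d * 4 ^ d) * 𝓜.card
        * ((17 / 16) ^ (F.support A).card * (9 / 32) ^ (F.support A).card) := by ring
    _ = 64 ^ d * 𝓜.card * (153 / 512) ^ (F.support A).card := by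
        rw [← mul_pow, ← mul_pow]; norm_num
    _ ≤ 64 ^ d * 𝓜.card * (9 / 10 * (1 / 3)) ^ (F.support A).card := by
        gcongr; norm_num
    _ = 64 ^ d * 𝓜.card * (9 / 10) ^ (F.support A).card * (1 / 3) ^ (F.support A).card := by
        rw [mul_pow, ← mul_assoc]
    _ ≤ _ := by
        gcongr _ * ?_ * _
        exact pow_le_pow_of_le_one (by norm_num) (by norm_num) hq

/-! ### Gap variables and the typical size of `S` -/

open Classical in
/-- The variables that occur in a satisfiable term of width at most `W`, but in none whose width
is in `(W, m * W]`. -/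
def gapVars (F : DNF n) (m W : ℕ) : Finset (Fin n) :=
  univ.filter fun i => (∃ j ∈ F.satTerms, i ∈ (F.term j).vars ∧ (F.term j).vars.card ≤ W) ∧
    ∀ j ∈ F.satTerms, i ∈ (F.term j).vars → (F.term j).vars.card ≤ W ∨
      m * W < (F.term j).vars.card

/-- By the pigeonhole principle, each variable of a short term has a gap between the widths of its
terms at one of `k` scales. -/
lemma vars_subset_biUnion_gapVars {F : DNF n} {k : ℕ} (hk : F.HasRead k) {m : ℕ} (hm : 1 ≤ m)
    {j : Fin F.size} (hj : j ∈ F.satTerms) (hjm : (F.term j).vars.card ≤ m) :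
    (F.term j).vars ⊆ (Icc 1 k).biUnion fun a => F.gapVars m (m ^ a) := by
  classical
  intro i hi
  by_contra hcon
  have hex : ∀ a, ∃ j', a ≤ k → i ∈ (F.term j').vars ∧ (F.term j').vars.card ≤ m ^ (a + 1) ∧
      (1 ≤ a → m ^ a < (F.term j').vars.card) := by
    intro a
    rcases Nat.eq_zero_or_pos a with rfl | ha
    · exact ⟨j, fun _ => ⟨hi, by simpa using hjm, by simp⟩⟩
    by_cases hak : a ≤ k
    swap
    · exact ⟨j, fun h => absurd h hak⟩
    have hna : i ∉ F.gapVars m (m ^ a) := fun h =>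
      hcon (mem_biUnion.2 ⟨a, mem_Icc.2 ⟨ha, hak⟩, h⟩)
    have h1 : ∃ j ∈ F.satTerms, i ∈ (F.term j).vars ∧ (F.term j).vars.card ≤ m ^ a :=
      ⟨j, hj, hi, hjm.trans (Nat.le_self_pow (by lia) m)⟩
    have h2 : ¬ ∀ j ∈ F.satTerms, i ∈ (F.term j).vars → (F.term j).vars.card ≤ m ^ a ∨
        m * m ^ a < (F.term j).vars.card := fun h => hna (mem_filter.2 ⟨mem_univ _, h1, h⟩)
    push Not at h2
    obtain ⟨j', _, hij', hlt, hle⟩ := h2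
    exact ⟨j', fun _ => ⟨hij', by rwa [pow_succ, mul_comm], fun _ => hlt⟩⟩
  choose g hg using hex
  have hlt : ∀ a b, a < b → b ≤ k → (F.term (g a)).vars.card < (F.term (g b)).vars.card := by
    intro a b hab hb
    exact ((hg a (by lia)).2.1.trans (Nat.pow_le_pow_right hm hab)).trans_lt
      ((hg b hb).2.2 (by lia))
  have hinj : Set.InjOn g (Icc 0 k : Finset ℕ) := by
    intro a ha b hb hab
    have ha := (mem_Icc.1 (mem_coe.1 ha)).2
    have hb := (mem_Icc.1 (mem_coe.1 hb)).2
    rcases lt_trichotomy a b with h | h | h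
    · exact absurd (hlt a b h hb) (by rw [hab]; exact lt_irrefl _)
    · exact h
    · exact absurd (hlt b a h ha) (by rw [hab]; exact lt_irrefl _)
  have hcard := card_le_card_of_injOn (s := Icc 0 k)
    (t := univ.filter fun j => i ∈ (F.term j).vars) g
    (fun a ha => by simpa using (hg a (mem_Icc.1 (mem_coe.1 ha)).2).1) hinj
  have := hcard.trans (hk i)
  simp at this

/-- There are at most `k * u * 2 ^ u * τ` satisfiable terms of width at most `u`. -/
def FewTerms (F : DNF n) (k τ : ℕ) : Prop :=
  ∀ u, (F.satTerms.filter fun j => (F.term j).vars.card ≤ u).card ≤ k * (u * (2 ^ u * τ))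

lemma card_support_filter_le {F : DNF n} {k τ : ℕ} (hfew : F.FewTerms k τ) (W : ℕ) :
    (F.support (F.satTerms.filter fun j => (F.term j).vars.card ≤ W)).card
      ≤ k * W ^ 2 * 2 ^ W * τ := by
  refine (card_biUnion_le_card_mul _ _ W fun j hj => (mem_filter.1 hj).2).trans ?_
  refine (Nat.mul_le_mul_right _ (hfew W)).trans (le_of_eq ?_)
  ring

lemma gapVars_subset (F : DNF n) {m V W : ℕ} (hVW : V ≤ W) :
    F.gapVars m V ⊆ F.support (F.satTerms.filter fun j => (F.term j).vars.card ≤ W) := by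
  intro i hi
  obtain ⟨j, hj, hij, hc⟩ := (mem_filter.1 hi).2.1
  exact mem_biUnion.2 ⟨j, mem_filter.2 ⟨hj, hc.trans hVW⟩, hij⟩

lemma poly_mul_two_pow_le {k W : ℕ} (hkW : k ≤ W) : k ^ 2 * W ^ 2 * 2 ^ W ≤ 32 ^ W := by
  have hW : W ≤ 2 ^ W := Nat.lt_two_pow_self.le
  calc k ^ 2 * W ^ 2 * 2 ^ W ≤ (2 ^ W) ^ 2 * (2 ^ W) ^ 2 * 2 ^ W := by
        gcongr
        exact hkW.trans hW
    _ = 32 ^ W := by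
        rw [← pow_mul, ← pow_add, ← pow_add, show W * 2 + W * 2 + W = 5 * W by ring, pow_mul]
        norm_num

lemma pow_le_choose_of_mul_le {b τ D : ℕ} (h : τ * (b + 1) ≤ D) :
    (b : ℝ) ^ τ ≤ D.choose τ := by
  refine le_trans ?_ (Nat.pow_le_choose τ D)
  rw [le_div_iff₀ (by positivity)]
  have h1 : b * τ ≤ D + 1 - τ := by
    have : τ * (b + 1) = b * τ + τ := by ring
    lia
  calc (b : ℝ) ^ τ * (τ.factorial : ℝ) ≤ b ^ τ * τ ^ τ := by
        gcongr
        exact_mod_cast Nat.factorial_le_pow τ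
    _ = ((b * τ : ℕ) : ℝ) ^ τ := by rw [← mul_pow]; push_cast; rfl
    _ ≤ _ := by gcongr

/-- Few variables of a typical `S` are gap variables. -/
lemma sum_gapVars_le {F : DNF n} {k τ l W D : ℕ} (hk : F.HasRead k) (hk0 : 0 < k) (hl : 100 ≤ l)
    (hfew : F.FewTerms k τ) (hkW : k ≤ W) (hτ : 2 ≤ τ) (hD : 100 * τ * (k + 1) * W ≤ D) :
    ∑ S with D ≤ (S ∩ F.gapVars (k * l) W).card, fourierCoeff F.eval S ^ 2
      ≤ (1 / 2) ^ τ / (16 * (k + 1)) := by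
  classical
  set X := F.gapVars (k * l) W
  set 𝓛 := (F.satTerms ∩ F.hitting X).filter fun j => k * l * W < (F.term j).vars.card
  have hW : 1 ≤ W := hk0.trans_le hkW
  have hX : ∀ j, (∃ x, (F.term j).Sat x) → ((F.term j).vars ∩ X).Nonempty →
      (F.term j).vars.card ≤ W ∨ j ∈ 𝓛 := by
    intro j hs hne
    obtain ⟨i, hi⟩ := hne
    obtain ⟨hij, hiX⟩ := mem_inter.1 hi
    refine ((mem_filter.1 hiX).2.2 j (mem_satTerms.2 hs) hij).imp id fun h => ?_
    exact mem_filter.2 ⟨mem_inter.2 ⟨mem_satTerms.2 hs, mem_hitting.2 ⟨i, hi⟩⟩, h⟩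
  have h1 := (choose_mul_sum_le F.eval X τ D).trans
    (F.sum_powersetCard_fourierCoeff_sq_le hW hX τ)
  have h𝓛card : 𝓛.card ≤ k ^ 2 * W ^ 2 * 2 ^ W * τ := by
    calc 𝓛.card ≤ (F.hitting X).card :=
          card_le_card ((filter_subset _ _).trans inter_subset_right)
      _ ≤ k * X.card := card_hitting_le hk X
      _ ≤ k * (k * W ^ 2 * 2 ^ W * τ) := by
          gcongr
          exact (card_le_card (F.gapVars_subset le_rfl)).trans (card_support_filter_le hfew W)
      _ = _ := by ring
  -- There are at most `32^W * τ` long terms, and each contributes a factor `(3/4)^(l * W) ≤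
  -- 32^{-W}`.
  have h2 : ∑ A ∈ 𝓛.powerset, (3 / 4 : ℝ) ^ (F.support A).card ≤ Real.exp 1 ^ τ := by
    refine (sum_pow_card_support_le (m := l * W) hk hk0 (fun j hj => ?_) (by norm_num)
      (by norm_num)).trans ((one_add_pow_le_exp (by positivity) _).trans ?_)
    · rw [← mul_assoc]; exact (mem_filter.1 hj).2.le
    rw [← Real.exp_nat_mul, mul_one]
    refine Real.exp_le_exp.2 ?_
    have h3 : (𝓛.card : ℝ) ≤ 32 ^ W * τ := by
      exact_mod_cast h𝓛card.trans (Nat.mul_le_mul_right _ (poly_mul_two_pow_le hkW))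
    calc (𝓛.card : ℝ) * (3 / 4) ^ (l * W) ≤ (32 ^ W * τ) * ((3 / 4) ^ l) ^ W := by
          rw [pow_mul]; gcongr
      _ ≤ (32 ^ W * τ) * (1 / 32) ^ W := by
          gcongr
          calc (3 / 4 : ℝ) ^ l ≤ (3 / 4) ^ 100 :=
                pow_le_pow_of_le_one (by norm_num) (by norm_num) hl
            _ ≤ 1 / 32 := by norm_num
      _ = τ * (32 * (1 / 32)) ^ W := by rw [mul_pow]; ring
      _ = τ := by norm_num
  have hW0 : (0 : ℝ) < W := by exact_mod_cast hW
  have hchoose : (99 * (k + 1) * W : ℝ) ^ τ ≤ D.choose τ := by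
    have := pow_le_choose_of_mul_le (b := 99 * (k + 1) * W) (τ := τ) (D := D) (by
      refine le_trans ?_ hD
      have : 1 ≤ (k + 1) * W := Nat.mul_pos (by lia) hW
      calc τ * (99 * (k + 1) * W + 1) ≤ τ * (99 * (k + 1) * W + (k + 1) * W) := by gcongr
        _ = 100 * τ * (k + 1) * W := by ring)
    exact_mod_cast this
  set tail := ∑ S with D ≤ (S ∩ X).card, fourierCoeff F.eval S ^ 2
  have htail : 0 ≤ tail := sum_nonneg fun _ _ => sq_nonneg _
  have h4 : (99 * (k + 1) * W : ℝ) ^ τ * tail ≤ (4 * W) ^ τ * Real.exp 1 ^ τ := by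
    refine (mul_le_mul_of_nonneg_right hchoose htail).trans (h1.trans ?_)
    gcongr
  have h5 : tail ≤ (1 / (8 * (k + 1))) ^ τ := by
    have hpos : (0 : ℝ) < (99 * (k + 1) * W) ^ τ := by positivity
    refine le_of_mul_le_mul_left (h4.trans ?_) hpos
    rw [← mul_pow, ← mul_pow]
    refine pow_le_pow_left₀ (by positivity) ?_ _
    -- The comparison needed is `4e ≤ 99/8`.
    have he := Real.exp_one_lt_d9
    have : (99 * (k + 1) * W : ℝ) * (1 / (8 * (k + 1))) = 99 / 8 * W := by field_simp
    rw [this]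
    nlinarith
  refine h5.trans ?_
  have hk1 : (1 : ℝ) ≤ k + 1 := by linarith [(Nat.cast_nonneg k : (0 : ℝ) ≤ k)]
  have h6 : (1 / 8 : ℝ) ^ τ ≤ (1 / 2) ^ τ * (1 / 16) := by
    calc (1 / 8 : ℝ) ^ τ = (1 / 2) ^ τ * (1 / 4) ^ τ := by rw [← mul_pow]; norm_num
      _ ≤ (1 / 2) ^ τ * (1 / 4) ^ 2 := by
        gcongr _ * ?_
        exact pow_le_pow_of_le_one (by norm_num) (by norm_num) hτ
      _ = _ := by norm_num
  calc (1 / (8 * (k + 1)) : ℝ) ^ τ = (1 / 8) ^ τ * (1 / (k + 1)) ^ τ := by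
        rw [← mul_pow]; congr 1; field_simp
    _ ≤ ((1 / 2) ^ τ * (1 / 16)) * (1 / (k + 1)) ^ 1 := by
        gcongr ?_ * ?_
        exact pow_le_pow_of_le_one (by positivity) ((div_le_one (by positivity)).2 hk1) (by lia)
    _ = _ := by field_simp

/-- A typical `S` is small. -/
lemma sum_card_ge_le {F : DNF n} {w τ : ℕ} (hw : F.HasWidth w) (hw1 : 1 ≤ w) (hτ : 2 ≤ τ) :
    ∑ S with 33 * w * τ ≤ S.card, fourierCoeff F.eval S ^ 2 ≤ (1 / 2) ^ τ / 16 := by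
  have h1 := (choose_mul_sum_le F.eval univ τ (33 * w * τ)).trans
    (F.sum_powersetCard_fourierCoeff_sq_le hw1 (𝓛 := ∅) (fun j _ _ => Or.inl (hw j)) τ)
  simp only [inter_univ, powerset_empty, sum_singleton, support, biUnion_empty, card_empty,
    pow_zero, mul_one] at h1
  have hchoose := pow_le_choose_of_mul_le (b := 32 * w) (τ := τ) (D := 33 * w * τ) (by nlinarith)
  set tail := ∑ S with 33 * w * τ ≤ S.card, fourierCoeff F.eval S ^ 2
  have htail : 0 ≤ tail := sum_nonneg fun _ _ => sq_nonneg _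
  have hw0 : (0 : ℝ) < w := by exact_mod_cast hw1
  have h2 : tail ≤ (1 / 8) ^ τ := by
    have hpos : (0 : ℝ) < ((32 * w : ℕ) : ℝ) ^ τ := by positivity
    refine le_of_mul_le_mul_left
      ((mul_le_mul_of_nonneg_right hchoose htail).trans (h1.trans (le_of_eq ?_))) hpos
    rw [← mul_pow]
    push_cast
    congr 1
    ring
  refine h2.trans ?_
  calc (1 / 8 : ℝ) ^ τ = (1 / 2) ^ τ * (1 / 4) ^ τ := by rw [← mul_pow]; norm_num
    _ ≤ (1 / 2) ^ τ * (1 / 4) ^ 2 := by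
      gcongr _ * ?_
      exact pow_le_pow_of_le_one (by norm_num) (by norm_num) hτ
    _ = _ := by norm_num; ring

/-! ### Choice of parameters and assembly -/

lemma natCast_mul_pow_le {k : ℕ} {c : ℝ} (hk : 1 ≤ k) (hc : 0 ≤ c) (hc1 : c ≤ 1 / 2) :
    (k : ℝ) * c ^ k ≤ 2 * c := by
  have h : (k : ℝ) ≤ 2 ^ k := by exact_mod_cast Nat.lt_two_pow_self.le
  calc (k : ℝ) * c ^ k ≤ 2 ^ k * c ^ k := by gcongr
    _ = (2 * c) ^ k := (mul_pow _ _ _).symm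
    _ ≤ (2 * c) ^ 1 := pow_le_pow_of_le_one (by positivity) (by linarith) hk
    _ = _ := pow_one _

lemma natCast_mul_pow_mul_le {k : ℕ} {c b : ℝ} (m : ℕ) (hk : 1 ≤ k) (hc : 0 ≤ c)
    (hc1 : c ^ m ≤ 1 / 2) (hb : 2 * c ^ m ≤ b) : (k : ℝ) * c ^ (m * k) ≤ b := by
  rw [pow_mul]
  exact (natCast_mul_pow_le hk (by positivity) hc1).trans hb

/-- Width `u` contributes at most `k * u * 2^u * τ * (4/9)^u`. Bounding `u` by `18 * (19/18)^u`
leaves a geometric series of ratio `(19/18) * (8/9) = 76/81`. -/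
lemma sum_long_terms_le {F : DNF n} {k τ w m : ℕ} (hfew : F.FewTerms k τ) (hw : F.HasWidth w)
    (hm : (k : ℝ) * (76 / 81) ^ m ≤ 1 / 300) :
    ∑ j ∈ F.satTerms with m < (F.term j).vars.card, (4 / 9 : ℝ) ^ (F.term j).vars.card ≤ τ := by
  classical
  have hmaps : ∀ j ∈ F.satTerms.filter fun j => m < (F.term j).vars.card,
      (F.term j).vars.card ∈ Ico m (w + 1) := by
    intro j hj
    have h1 := (mem_filter.1 hj).2
    have h2 := hw j
    exact mem_Ico.2 ⟨h1.le, by lia⟩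
  rw [← sum_fiberwise_of_maps_to hmaps]
  have hu : ∀ u ∈ Ico m (w + 1),
      ∑ j ∈ F.satTerms.filter (fun j => m < (F.term j).vars.card) with (F.term j).vars.card = u,
        (4 / 9 : ℝ) ^ (F.term j).vars.card ≤ 18 * k * τ * (76 / 81) ^ u := by
    intro u _
    have hsub : ((F.satTerms.filter fun j => m < (F.term j).vars.card).filter
        fun j => (F.term j).vars.card = u)
        ⊆ F.satTerms.filter fun j => (F.term j).vars.card ≤ u := by
      intro j hj
      obtain ⟨h1, h2⟩ := mem_filter.1 hj
      exact mem_filter.2 ⟨(mem_filter.1 h1).1, h2.le⟩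
    have hcard : (((F.satTerms.filter fun j => m < (F.term j).vars.card).filter
        fun j => (F.term j).vars.card = u).card : ℝ) ≤ k * (u * (2 ^ u * τ)) := by
      exact_mod_cast (card_le_card hsub).trans (hfew u)
    have hbern : (u : ℝ) ≤ 18 * (19 / 18) ^ u := by
      have := one_add_mul_le_pow (by norm_num : (-2 : ℝ) ≤ 1 / 18) u
      norm_num at this ⊢
      linarith
    rw [sum_congr rfl fun j hj => by rw [(mem_filter.1 hj).2], sum_const, nsmul_eq_mul]
    calc _ ≤ (k * (u * (2 ^ u * τ)) : ℝ) * (4 / 9) ^ u := by gcongr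
      _ ≤ (k * ((18 * (19 / 18) ^ u) * (2 ^ u * τ)) : ℝ) * (4 / 9) ^ u := by gcongr
      _ = 18 * k * τ * ((19 / 18) * 2 * (4 / 9)) ^ u := by rw [mul_pow, mul_pow]; ring
      _ = _ := by norm_num
  refine (sum_le_sum hu).trans ?_
  rw [← mul_sum]
  calc _ ≤ 18 * k * τ * ((76 / 81 : ℝ) ^ m / (1 - 76 / 81)) := by
        gcongr
        exact geom_sum_Ico_le_of_lt_one (by norm_num) (by norm_num)
    _ = (k * (76 / 81 : ℝ) ^ m) * (18 * 81 / 5 * τ) := by ring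
    _ ≤ 1 / 300 * (18 * 81 / 5 * τ) := by gcongr
    _ ≤ τ := by
        have : (0 : ℝ) ≤ τ := Nat.cast_nonneg τ
        linarith

lemma scale_arith {k w : ℕ} (hk : 1 ≤ k) (hkw : (100 * k) ^ (16 * k) ≤ w) :
    2 + 400 * k * (k + 1) * ((200 * k ^ 2) ^ k) ^ 2 ≤ w := by
  refine le_trans ?_ hkw
  have h1 : (100 * k) ^ (16 * k) = ((10000 * k ^ 2) ^ k) ^ 2 * (10000 * k ^ 2) ^ (6 * k) := by
    rw [← pow_mul, ← pow_add, show k * 2 + 6 * k = 8 * k by ring,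
      show 10000 * k ^ 2 = (100 * k) ^ 2 by ring, ← pow_mul]
    congr 1; ring
  rw [h1]
  have h2 : 1 ≤ ((200 * k ^ 2) ^ k) ^ 2 := Nat.one_le_iff_ne_zero.2 (by positivity)
  have h3 : 10000 * k ^ 2 ≤ (10000 * k ^ 2) ^ (6 * k) := Nat.le_self_pow (by lia) _
  calc 2 + 400 * k * (k + 1) * ((200 * k ^ 2) ^ k) ^ 2
      ≤ 2 * ((200 * k ^ 2) ^ k) ^ 2 + 400 * k * (k + 1) * ((200 * k ^ 2) ^ k) ^ 2 := by lia
    _ = ((200 * k ^ 2) ^ k) ^ 2 * (2 + 400 * k * (k + 1)) := by ring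
    _ ≤ ((10000 * k ^ 2) ^ k) ^ 2 * (10000 * k ^ 2) ^ (6 * k) := by
        gcongr ?_ * ?_
        · gcongr; norm_num
        · exact le_trans (by nlinarith) h3

/-- The concentration theorem with explicit parameters, for formulas with few short terms. -/
theorem exists_concentrated_of_fewTerms {F : DNF n} {k τ w : ℕ} (hk : F.HasRead k) (hk0 : 1 ≤ k)
    (hw : F.HasWidth w) (hkw : (100 * k) ^ (16 * k) ≤ w) (hτ : 2 ≤ τ)
    (hne : ∀ j ∈ F.satTerms, (F.term j).vars.Nonempty) (hfew : F.FewTerms k τ) :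
    ∃ 𝓢 : Finset (Finset (Fin n)), (𝓢.card : ℝ) ≤ 2 ^ (4202 * (w * τ)) ∧
      ConcentratedOn F.eval ((1 / 2) ^ τ) 𝓢 := by
  classical
  have harith := scale_arith hk0 hkw
  have hw2 : 2 ≤ w := le_trans (by lia) harith
  -- One factor `k` absorbs the double counting in supports; the factor `200 * k` makes `k * c ^
  -- (200 * k)` small for the bases `c` in use.
  set m := k * (200 * k) with hm
  have hmk : 200 * k ^ 2 = m := by rw [hm]; ring
  rw [hmk] at harith
  have hm1 : k ≤ m := by nlinarith
  set W := m ^ k with hW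
  have hWa : ∀ a ∈ Icc 1 k, k ≤ m ^ a ∧ m ^ a ≤ W := fun a ha =>
    ⟨hm1.trans (Nat.le_self_pow (by have := (mem_Icc.1 ha).1; lia) m),
      Nat.pow_le_pow_right (hk0.trans hm1) (mem_Icc.1 ha).2⟩
  have hkW : k ≤ W := (hWa k (mem_Icc.2 ⟨hk0, le_rfl⟩)).1
  set X := (Icc 1 k).biUnion fun a => F.gapVars m (m ^ a) with hX
  set D := 100 * τ * (k + 1) * W with hD
  set 𝓜 := X.powerset.filter fun Y => Y.card ≤ k * D
  set 𝓑 := F.satTerms.filter fun j => m < (F.term j).vars.card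
  set q := 1400 * (w * τ) with hq
  have hlong : ∀ j ∈ 𝓑, k * (200 * k) ≤ (F.term j).vars.card := fun j hj =>
    (mem_filter.1 hj).2.le
  have hcov : ∀ j ∈ F.satTerms, ¬ (F.term j).vars ⊆ X → j ∈ 𝓑 := by
    intro j hj hsub
    refine mem_filter.2 ⟨hj, ?_⟩
    by_contra hle
    exact hsub (vars_subset_biUnion_gapVars hk (hk0.trans hm1) hj (not_lt.1 hle))
  have hexp : Real.exp τ ≤ 2 ^ (2 * τ) := by
    rw [pow_mul, ← mul_one (τ : ℝ), Real.exp_nat_mul]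
    gcongr
    linarith [Real.exp_one_lt_d9]
  have hwτ : 2 * τ ≤ w * τ := by gcongr
  have hA : ∑ A ∈ 𝓑.powerset, (1 / 3 : ℝ) ^ (F.support A).card ≤ 2 ^ (w * τ) := by
    refine (sum_third_pow_card_support_le hk hk0 ?_ hlong fun j hj =>
      hne j (mem_filter.1 hj).1).trans ?_
    · exact natCast_mul_pow_mul_le 200 hk0 (by norm_num) (by norm_num) (by norm_num)
    · calc _ ≤ Real.exp τ := by
            refine Real.exp_le_exp.2 (sum_long_terms_le hfew hw ?_)
            calc (k : ℝ) * (76 / 81) ^ m ≤ k * (76 / 81) ^ (200 * k) := by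
                  gcongr _ * ?_
                  exact pow_le_pow_of_le_one (by norm_num) (by norm_num)
                    (Nat.le_mul_of_pos_left _ hk0)
              _ ≤ _ := natCast_mul_pow_mul_le 200 hk0 (by norm_num) (by norm_num) (by norm_num)
        _ ≤ 2 ^ (2 * τ) := hexp
        _ ≤ _ := pow_le_pow_right₀ (by norm_num) hwτ
  have hMcard : (𝓜.card : ℝ) ≤ 2 ^ (w * τ) := by
    have hXcard : X.card ≤ k * W ^ 2 * 2 ^ W * τ := by
      refine (card_le_card ?_).trans (card_support_filter_le hfew W)
      exact biUnion_subset.2 fun a ha => F.gapVars_subset (hWa a ha).2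
    set b := k * W ^ 2 * 2 ^ W with hb
    have hW0 : 0 < W := hk0.trans hkW
    have hb0 : (0 : ℝ) < b := by positivity
    have hb1 : (1 : ℝ) ≤ b := by exact_mod_cast (by positivity : 0 < b)
    have hb2 : b ≤ 2 ^ (4 * W) := by
      have h2 : W ≤ 2 ^ W := Nat.lt_two_pow_self.le
      calc b ≤ 2 ^ W * (2 ^ W) ^ 2 * 2 ^ W := by
            rw [hb]
            gcongr
            exact hkW.trans h2
        _ = _ := by ring
    -- The choice `c = 1 / b` is dictated by `X.card ≤ b * τ`: it makes `(1 + c) ^ X.card` at most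
    -- `e^τ`.
    have h1 := card_filter_card_le X (k * D) (c := 1 / b) (by positivity)
      ((div_le_one hb0).2 hb1)
    rw [one_div_one_div] at h1
    calc (𝓜.card : ℝ) ≤ (b : ℝ) ^ (k * D) * (1 + 1 / b) ^ X.card := h1
      _ ≤ (2 ^ (4 * W)) ^ (k * D) * Real.exp τ := by
          gcongr
          · exact_mod_cast hb2
          · refine (one_add_pow_le_exp (by positivity) _).trans (Real.exp_le_exp.2 ?_)
            rw [mul_one_div, div_le_iff₀ hb0]
            calc (X.card : ℝ) ≤ ((b * τ : ℕ) : ℝ) := by exact_mod_cast hXcard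
              _ = τ * b := by push_cast; ring
      _ ≤ (2 ^ (4 * W)) ^ (k * D) * 2 ^ (2 * τ) := by gcongr
      _ = 2 ^ (4 * W * (k * D) + 2 * τ) := by rw [← pow_mul, pow_add]
      _ ≤ 2 ^ (w * τ) := by
          refine pow_le_pow_right₀ (by norm_num) ?_
          calc 4 * W * (k * D) + 2 * τ = (2 + 400 * k * (k + 1) * W ^ 2) * τ := by
                rw [hD]; ring
            _ ≤ w * τ := by gcongr
  refine ⟨F.coveredSets X 𝓑 𝓜 q, ?_, ?_⟩
  · refine (F.card_coveredSets_le X 𝓑 𝓜 q).trans ?_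
    calc (𝓜.card : ℝ) * 6 ^ q * ∑ A ∈ 𝓑.powerset, (1 / 3 : ℝ) ^ (F.support A).card
        ≤ 2 ^ (w * τ) * (2 ^ 3) ^ q * 2 ^ (w * τ) := by
          gcongr
          norm_num
      _ = 2 ^ (4202 * (w * τ)) := by
          rw [← pow_mul, ← pow_add, ← pow_add, hq]
          congr 1; ring
  · unfold ConcentratedOn
    set B₁ := univ.filter fun S : Finset (Fin n) => 33 * w * τ ≤ S.card
    set B₂ := fun a => univ.filter fun S : Finset (Fin n) =>
      D ≤ (S ∩ F.gapVars m (m ^ a)).card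
    set B₃ := univ.filter fun S : Finset (Fin n) =>
      (S.card ≤ 33 * w * τ ∧ S ∩ X ∈ 𝓜) ∧ S ∉ F.coveredSets X 𝓑 𝓜 q
    have hsub : (F.coveredSets X 𝓑 𝓜 q)ᶜ ⊆ (B₁ ∪ (Icc 1 k).biUnion B₂) ∪ B₃ := by
      intro S hS
      rw [mem_compl] at hS
      by_contra hcon
      simp only [mem_union, not_or] at hcon
      obtain ⟨⟨h1, h2⟩, h3⟩ := hcon
      have h1' : S.card < 33 * w * τ := by simpa [B₁] using h1
      refine h3 (mem_filter.2 ⟨mem_univ _, ⟨h1'.le, mem_filter.2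
        ⟨mem_powerset.2 inter_subset_right, ?_⟩⟩, hS⟩)
      rw [hX, inter_biUnion]
      refine (card_biUnion_le_card_mul _ _ D fun a ha => ?_).trans (by simp)
      by_contra hlt
      exact h2 (mem_biUnion.2 ⟨a, ha, mem_filter.2 ⟨mem_univ _, by lia⟩⟩)
    have hB₁ : ∑ S ∈ B₁, fourierCoeff F.eval S ^ 2 ≤ (1 / 2) ^ τ / 16 :=
      sum_card_ge_le hw (by lia) hτ
    have hB₂ : ∀ a ∈ Icc 1 k, ∑ S ∈ B₂ a, fourierCoeff F.eval S ^ 2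
        ≤ (1 / 2) ^ τ / (16 * (k + 1)) := fun a ha =>
      sum_gapVars_le hk hk0 (by lia) hfew (hWa a ha).1 hτ (by
        rw [hD]
        gcongr
        exact (hWa a ha).2)
    have hB₃ : ∑ S ∈ B₃, fourierCoeff F.eval S ^ 2 ≤ (1 / 2) ^ τ / 16 := by
      refine (sum_not_covered_le hk hk0 ?_ hlong hcov 𝓜 (33 * w * τ) q).trans ?_
      · exact natCast_mul_pow_mul_le 200 hk0 (by norm_num) (by norm_num) (by norm_num)
      -- The exponent of 2 per `w * τ` is `6 * 33 + 1 + 1 = 200`; the constant 1400 in `q` is large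
      -- enough to beat it.
      calc (64 : ℝ) ^ (33 * w * τ) * 𝓜.card * (9 / 10) ^ q
            * ∑ A ∈ 𝓑.powerset, (1 / 3 : ℝ) ^ (F.support A).card
          ≤ (64 : ℝ) ^ (33 * w * τ) * 2 ^ (w * τ) * (9 / 10) ^ q * 2 ^ (w * τ) := by gcongr
        _ = (2 ^ 200 * (9 / 10) ^ 1400) ^ (w * τ) := by
            rw [hq, pow_mul (9 / 10 : ℝ), mul_pow, mul_assoc 33 w τ, pow_mul (64 : ℝ),
              mul_right_comm, ← mul_pow, ← mul_pow]
            norm_num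
        _ ≤ (1 / 8) ^ (w * τ) := by
            gcongr
            calc (2 : ℝ) ^ 200 * (9 / 10) ^ 1400 = 2 ^ 200 * ((9 / 10) ^ 7) ^ 200 := by
                  rw [← pow_mul]
              _ = (2 * (9 / 10) ^ 7) ^ 200 := (mul_pow _ _ _).symm
              _ ≤ (96 / 100) ^ 200 := by gcongr; norm_num
              _ ≤ 1 / 8 := by norm_num
        _ ≤ (1 / 8) ^ (2 * τ) := pow_le_pow_of_le_one (by norm_num) (by norm_num) hwτ
        _ = (1 / 2) ^ τ * (1 / 32) ^ τ := by rw [pow_mul, ← mul_pow]; norm_num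
        _ ≤ (1 / 2) ^ τ * (1 / 32) ^ 1 := by
            gcongr _ * ?_
            exact pow_le_pow_of_le_one (by norm_num) (by norm_num) (by lia)
        _ ≤ _ := by
            have : (0 : ℝ) < (1 / 2) ^ τ := by positivity
            linarith
    have hunion : ∀ s t : Finset (Finset (Fin n)), ∑ S ∈ s ∪ t, fourierCoeff F.eval S ^ 2
        ≤ ∑ S ∈ s, fourierCoeff F.eval S ^ 2 + ∑ S ∈ t, fourierCoeff F.eval S ^ 2 := by
      intro s t
      rw [← sum_union_inter]
      linarith [sum_nonneg fun S (_ : S ∈ s ∩ t) => sq_nonneg (fourierCoeff F.eval S)]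
    have hB₂' : ∑ S ∈ (Icc 1 k).biUnion B₂, fourierCoeff F.eval S ^ 2 ≤ (1 / 2) ^ τ / 16 := by
      have hsum : ∀ s : Finset ℕ, ∑ S ∈ s.biUnion B₂, fourierCoeff F.eval S ^ 2
          ≤ ∑ a ∈ s, ∑ S ∈ B₂ a, fourierCoeff F.eval S ^ 2 := by
        intro s
        induction s using Finset.induction_on with
        | empty => simp
        | insert a s ha ih =>
          rw [biUnion_insert, sum_insert ha]
          linarith [hunion (B₂ a) (s.biUnion B₂)]
      refine (hsum _).trans ((sum_le_card_nsmul _ _ _ hB₂).trans ?_)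
      have hp : (0 : ℝ) < (1 / 2) ^ τ := by positivity
      rw [Nat.card_Icc, Nat.add_sub_cancel, nsmul_eq_mul, mul_div_assoc', div_le_div_iff₀
        (by positivity) (by norm_num)]
      nlinarith
    have h1 := hunion (B₁ ∪ (Icc 1 k).biUnion B₂) B₃
    have h2 := hunion B₁ ((Icc 1 k).biUnion B₂)
    have h3 := sum_le_sum_of_subset_of_nonneg hsub
      fun S _ _ => sq_nonneg (fourierCoeff F.eval S)
    have : (0 : ℝ) < (1 / 2) ^ τ := by positivity
    linarith

lemma concentratedOn_singleton_empty {F : DNF n} {ε : ℝ}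
    (h : ∑ S with S ≠ ∅, fourierCoeff F.eval S ^ 2 ≤ ε) : ConcentratedOn F.eval ε {∅} := by
  unfold ConcentratedOn
  convert h using 2
  ext S
  simp

/-- The concentration theorem with explicit parameters. -/
theorem exists_concentrated {F : DNF n} {k τ w : ℕ} (hk : F.HasRead k)
    (hw : F.HasWidth w) (hkw : k = 0 ∨ (100 * k) ^ (16 * k) ≤ w) (hτ : 2 ≤ τ) :
    ∃ 𝓢 : Finset (Finset (Fin n)), (𝓢.card : ℝ) ≤ 2 ^ (4202 * (w * τ)) ∧
      ConcentratedOn F.eval ((1 / 2) ^ τ) 𝓢 := by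
  rcases nearly_const_or_few_terms hk τ with h | ⟨hne, hfew⟩
  · exact ⟨{∅}, by simpa using one_le_pow₀ (by norm_num), concentratedOn_singleton_empty h⟩
  rcases Nat.eq_zero_or_pos k with rfl | hk0
  · refine ⟨{∅}, by simpa using one_le_pow₀ (by norm_num), concentratedOn_singleton_empty ?_⟩
    refine le_trans (le_of_eq (sum_eq_zero fun S hS => ?_)) (by positivity)
    obtain ⟨i, hi⟩ := nonempty_iff_ne_empty.2 (mem_filter.1 hS).2
    rw [fourierCoeff_eq_sum_topCoeff, sum_eq_zero, zero_div, zero_pow two_ne_zero]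
    intro x _
    refine topCoeff_eval_eq_zero hi fun j _ hij => ?_
    have := card_eq_zero.1 (Nat.le_zero.1 (hk i))
    exact (eq_empty_iff_forall_notMem.1 this j) (by simpa using hij)
  · exact exists_concentrated_of_fewTerms hk hk0 hw (hkw.resolve_left hk0.ne') hτ hne hfew

end DNF

/-! ### From the logarithmic hypothesis on `k` to powers -/

lemma le_logb_two_of_two_pow_le {x : ℝ} (hx : 0 < x) {m : ℕ} (h : 2 ^ m ≤ x ^ 2) :
    (m : ℝ) / 2 ≤ Real.logb 2 x := by
  have h1 : (m : ℝ) ≤ Real.logb 2 (x ^ 2) := by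
    rw [Real.le_logb_iff_rpow_le one_lt_two (by positivity), Real.rpow_natCast]
    exact h
  rw [Real.logb_pow] at h1
  push_cast at h1
  linarith

/-- Bootstrapping: a lower bound on `x` bounds `log x` below, and the hypothesis turns this into a
better bound on `x`, through 8, 16, 64, 96 and 104. -/
lemma hundred_le_of_sixteen_mul_logb_le {x : ℝ} (hx : 3 / 2 ≤ x)
    (h : 16 * Real.logb 2 x ≤ x) : 100 ≤ x := by
  have key : ∀ (m : ℕ) (y : ℝ), 0 ≤ y → 2 ^ m ≤ y ^ 2 → y ≤ x → 8 * (m : ℝ) ≤ x := by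
    intro m y hy hm hyx
    have := le_logb_two_of_two_pow_le (by linarith : 0 < x) (hm.trans (by gcongr))
    linarith
  have h1 := key 1 (3 / 2) (by norm_num) (by norm_num) hx
  have h2 := key 2 2 (by norm_num) (by norm_num) (by norm_num at h1; linarith)
  have h3 := key 8 16 (by norm_num) (by norm_num) (by norm_num at h2; linarith)
  have h4 := key 12 64 (by norm_num) (by norm_num) (by norm_num at h3; linarith)
  have h5 := key 13 96 (by norm_num) (by norm_num) (by norm_num at h4; linarith)
  norm_num at h5
  linarith

/-- For `k ≥ 1` the hypothesis forces `x = log w` to be at least 100, so `log x ≥ 13/2` and `100k ≤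
104k ≤ x`. Then `(100k)^{16k} ≤ x^{16k} = 2^{16k log x} ≤ 2^x = w`. -/
lemma pow_le_of_le_logb_div {k w : ℕ} (hw : 3 ≤ w)
    (hk : (k : ℝ) ≤ Real.logb 2 w / (16 * Real.logb 2 (Real.logb 2 w))) :
    k = 0 ∨ (100 * k) ^ (16 * k) ≤ w := by
  rcases Nat.eq_zero_or_pos k with rfl | hk0
  · exact Or.inl rfl
  right
  have hw' : (3 : ℝ) ≤ w := by exact_mod_cast hw
  have hk1 : (1 : ℝ) ≤ k := by exact_mod_cast hk0
  set x := Real.logb 2 w with hx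
  have hx1 : 3 / 2 ≤ x := by
    have := le_logb_two_of_two_pow_le (m := 3) (by linarith : (0 : ℝ) < w) (by nlinarith)
    simpa using this
  have hL : 0 < Real.logb 2 x := Real.logb_pos one_lt_two (by linarith)
  rw [le_div_iff₀ (by positivity)] at hk
  have hx2 : 100 ≤ x := hundred_le_of_sixteen_mul_logb_le hx1 (by nlinarith)
  have hL2 : 13 / 2 ≤ Real.logb 2 x := by
    have := le_logb_two_of_two_pow_le (m := 13) (by linarith : (0 : ℝ) < x) (by nlinarith)
    simpa using this
  have hkx : 100 * (k : ℝ) ≤ x := by nlinarith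
  have h1 : ((100 * k : ℝ)) ^ (16 * k) ≤ w := by
    calc ((100 * k : ℝ)) ^ (16 * k) ≤ x ^ (16 * k) := by gcongr
      _ = (2 : ℝ) ^ (Real.logb 2 x * (16 * k : ℕ)) := by
          rw [Real.rpow_mul two_pos.le, Real.rpow_logb two_pos (by norm_num) (by linarith),
            Real.rpow_natCast]
      _ ≤ (2 : ℝ) ^ x := by
          refine Real.rpow_le_rpow_of_exponent_le one_le_two ?_
          push_cast
          linarith
      _ = w := Real.rpow_logb two_pos (by norm_num) (by linarith)
  exact_mod_cast h1

end BooleanDNF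

end

theorem mainTheorem4 :
    ∃ C : ℝ, 0 < C ∧
      ∀ (n w k : ℕ) (F : BooleanDNF.DNF n) (ε : ℝ),
        3 ≤ w → F.HasWidth w → F.HasRead k →
        (k : ℝ) ≤ Real.logb 2 w / (16 * Real.logb 2 (Real.logb 2 w)) →
        0 < ε → ε ≤ 1 →
        BooleanDNF.ConcentratedOnCoeffs F.eval ε
          ((2 : ℝ) ^ (C * w * Real.logb 2 (1 / ε))) := by
  -- Here `8404 = 2 * 4202`; the factor 2 pays for rounding `log(1/ε)` up.
  refine ⟨8404, by norm_num, fun n w k F ε hw3 hw hk hkw hε hε1 => ?_⟩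
  set t := Real.logb 2 (1 / ε) with ht
  have ht0 : 0 ≤ t := Real.logb_nonneg one_lt_two ((one_le_div hε).2 hε1)
  -- The variance bound handles large `ε`; otherwise `log(1/ε) ≥ 2`, which supplies `τ ≥ 2`.
  by_cases hq : 1 / 4 ≤ ε
  · refine ⟨{∅}, ?_, BooleanDNF.DNF.concentratedOn_singleton_empty
      (F.sum_ne_empty_le_quarter.trans hq)⟩
    simpa using Real.one_le_rpow one_le_two (by positivity : 0 ≤ 8404 * (w : ℝ) * t)
  have h2t : (2 : ℝ) ^ t = 1 / ε := Real.rpow_logb two_pos (by norm_num) (by positivity)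
  have ht2 : 2 ≤ t := by
    rw [ht, Real.le_logb_iff_rpow_le one_lt_two (by positivity), le_div_iff₀ hε]
    norm_num
    linarith
  have hτt : t ≤ ⌈t⌉₊ := Nat.le_ceil t
  have hτ2 : 2 ≤ ⌈t⌉₊ := by exact_mod_cast ht2.trans hτt
  have hτ3 : (⌈t⌉₊ : ℝ) ≤ 2 * t := by linarith [Nat.ceil_lt_add_one ht0]
  obtain ⟨𝓢, hcard, hconc⟩ := BooleanDNF.DNF.exists_concentrated hk hw
    (BooleanDNF.pow_le_of_le_logb_div hw3 hkw) hτ2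
  refine ⟨𝓢, hcard.trans ?_, hconc.trans ?_⟩
  · rw [← Real.rpow_natCast]
    refine Real.rpow_le_rpow_of_exponent_le one_le_two ?_
    push_cast
    have : (w : ℝ) * ⌈t⌉₊ ≤ w * (2 * t) := by gcongr
    linarith
  · calc ((1 : ℝ) / 2) ^ ⌈t⌉₊ = 1 / 2 ^ ⌈t⌉₊ := by simp
      _ ≤ 1 / (2 : ℝ) ^ t := by
          rw [← Real.rpow_natCast]
          exact one_div_le_one_div_of_le (by positivity)
            (Real.rpow_le_rpow_of_exponent_le one_le_two hτt)
      _ = ε := by rw [h2t, one_div_one_div]
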